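/- Let $\theta=(\theta_n)_{n\in\mathbb Z}$ be a real weight that is an increasing (not necessarily strictly) function of $|n|$, with $\theta_n\ge 1$, and suppose that there are constants $D,\underline d,\overline d>0$ such that for all $n\in\mathbb Z$ $$|\theta_{n+1}-\theta_n|\le D\,\theta_n,\qquad \underline d\,\theta_n\le\theta_{n+1}\le\overline d\,\theta_n .$$ Let $\ell^2_\theta$ be the space of complex sequences $u=(u_n)_{n\in\mathbb Z}$ with $\|u\|^2_{\ell^2_\theta}=\sum_{n\in\mathbb Z}\theta_n|u_n|^2<\infty$. Let $g\in\ell^2_\theta$, $p>1$, $F(z)=|z|^{p-1}z$, and let $\hat\alpha,\hat\beta,\hat\gamma,\hat\delta,\hat\eta,\hat\zeta\in\mathbb R$ be such that $\hat\zeta>0$ and, for some $\epsilon>0$, $$\hat\delta-\frac{\epsilon}{2}-2\hat\beta-|\hat\alpha|D\,\underline d^{-1/2}-|\hat\beta|\Bigl(1+\frac{\overline d}{2}+\frac{\underline d^{-1}}{2}\Bigr)>0 .$$ Consider the infinite lattice equation $$i\dot u_n+(\hat\alpha+i\hat\beta)(u_{n-1}-2u_n+u_{n+1})+(\hat\gamma+i\hat\delta)u_n+(\hat\eta+i\hat\zeta)F(u_n)=g_n,\quad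 n\in\mathbb Z,\qquad (1)$$ and, for $N\in\mathbb N$, the finite system $$i\dot v_n+(\hat\alpha+i\hat\beta)(v_{n-1}-2v_n+v_{n+1})+(\hat\gamma+i\hat\delta)v_n+(\hat\eta+i\hat\zeta)F(v_n)=g_n,\quad |n|\le N,\qquad (2)$$ with $v_{-(N+1)}=v_{N+1}=0$, on $X_N=\mathbb C^{2N+1}$ with the norm $(\sum_{|n|\le N}\theta_n|v_n|^2)^{1/2}$; $X_N$ is viewed as a subspace of $\ell^2_\theta$ by extension by zero. Then (1) and (2) have, for every initial value in $\ell^2_\theta$ and in $X_N$ respectively, a unique solution of class $C^1$ on $[0,\infty)$ with values in $\ell^2_\theta$ and in $X_N$ respectively, and so define solution semigroups $S(t)$ on $\ell^2_\theta$ and $S_N(t)$ on $X_N$. Each of these semigroups has a unique global attractor (a compact set $\mathcal A$ with $S(t)\mathcal A=\mathcal A$ for all $t\ge0$ that attracts every bounded set $\mathcal B$ in the sense that $d(S(t)\mathcal B,\mathcal A)\to0$ as $t\to\infty$; likewise $\mathcal A_N\subset X_N$ for $S_N$), and $$\lim_{N\to\infty}d(\mathcal A_N,\mathcal A)=0,\qquad\text{where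 } d(\mathcal B_1,\mathcal B_2)=\sup_{x\in\mathcal B_1}\inf_{y\in\mathcal B_2}\|x-y\|_{\ell^2_\theta}.$$ -/

import Mathlib

open Filter Topology Set
open scoped NNReal ENNReal

noncomputable section

/-- A weight `θ` on `ℤ`: an increasing function of `|n|` (in the weak sense) with `θ_n ≥ 1`. -/
structure LatticeWeight where
  toFun : ℤ → ℝ
  mono : ∀ m n : ℤ, |m| ≤ |n| → toFun m ≤ toFun n
  one_le : ∀ n : ℤ, 1 ≤ toFun n

instance : CoeFun LatticeWeight (fun _ => ℤ → ℝ) := ⟨LatticeWeight.toFun⟩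

/-- Condition (WS) on the weight, with constants `D`, `dlow`, `dup`
(the bound `1 ≤ θ_n` is part of `LatticeWeight`). -/
structure LatticeWeight.WS (θ : LatticeWeight) (D dlow dup : ℝ) : Prop where
  D_pos : 0 < D
  dlow_pos : 0 < dlow
  dup_pos : 0 < dup
  increment : ∀ n : ℤ, |θ (n + 1) - θ n| ≤ D * θ n
  lower : ∀ n : ℤ, dlow * θ n ≤ θ (n + 1)
  upper : ∀ n : ℤ, θ (n + 1) ≤ dup * θ n

theorem LatticeWeight.nonneg (θ : LatticeWeight) (n : ℤ) : 0 ≤ θ n :=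
  zero_le_one.trans (θ.one_le n)

theorem LatticeWeight.memℓp_iff (θ : LatticeWeight) (u : ℤ → ℂ) :
    Memℓp (fun n => (Real.sqrt (θ n) : ℂ) * u n) 2 ↔ Summable (fun n => θ n * ‖u n‖ ^ 2) := by
  rw [memℓp_gen_iff (by norm_num)]
  refine summable_congr fun n => ?_
  simp [mul_pow, abs_of_nonneg (Real.sqrt_nonneg _), Real.sq_sqrt (θ.nonneg n)]

/-- The complex sequences with `∑ θ_n |u_n|² < ∞`, as a subspace of all sequences. -/
def weightedSubmodule (θ : LatticeWeight) : Submodule ℂ (ℤ → ℂ) where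
  carrier := {u | Summable (fun n => θ n * ‖u n‖ ^ 2)}
  zero_mem' := by simp
  add_mem' := by
    intro u v hu hv
    simp only [Set.mem_ofPred_eq, ← θ.memℓp_iff] at hu hv ⊢
    convert hu.add hv using 1
    funext n
    simp [mul_add]
  smul_mem' := by
    intro c u hu
    simp only [Set.mem_ofPred_eq, ← θ.memℓp_iff] at hu ⊢
    convert hu.const_smul c using 1
    funext n
    simp [mul_left_comm]

/-- The weighted space `ℓ²_θ`. It is a separate type so that it does not inherit the product
topology of `ℤ → ℂ`. -/
def WeightedL2 (θ : LatticeWeight) : Type := weightedSubmodule θ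

namespace WeightedL2

variable {θ : LatticeWeight}

instance : AddCommGroup (WeightedL2 θ) := inferInstanceAs (AddCommGroup (weightedSubmodule θ))

instance : Module ℂ (WeightedL2 θ) := inferInstanceAs (Module ℂ (weightedSubmodule θ))

/-- Coordinates of an element of `ℓ²_θ`. -/
instance : CoeFun (WeightedL2 θ) (fun _ => ℤ → ℂ) := ⟨fun u => u.1⟩

/-- `‖u‖ = (∑ θ_n |u_n|²)^{1/2}`. -/
instance : Norm (WeightedL2 θ) := ⟨fun u => Real.sqrt (∑' n : ℤ, θ n * ‖u n‖ ^ 2)⟩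

@[simp] theorem add_apply (u v : WeightedL2 θ) (n : ℤ) : (u + v) n = u n + v n := rfl

@[simp] theorem zero_apply (n : ℤ) : (0 : WeightedL2 θ) n = 0 := rfl

@[simp] theorem smul_apply (c : ℂ) (u : WeightedL2 θ) (n : ℤ) : (c • u) n = c * u n := rfl

theorem norm_def (u : WeightedL2 θ) : ‖u‖ = Real.sqrt (∑' n : ℤ, θ n * ‖u n‖ ^ 2) := rfl

/-- Multiplication by `√θ_n`, into the unweighted `ℓ²`. -/
def toL2 (u : WeightedL2 θ) : lp (fun _ : ℤ => ℂ) 2 :=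
  ⟨fun n => (Real.sqrt (θ n) : ℂ) * u n, (θ.memℓp_iff _).2 u.2⟩

theorem norm_toL2 (u : WeightedL2 θ) : ‖toL2 u‖ = ‖u‖ := by
  have h2 : (0 : ℝ) < ((2 : ℝ≥0∞)).toReal := by norm_num
  rw [lp.norm_eq_tsum_rpow h2, norm_def, Real.sqrt_eq_rpow]
  simp [toL2, mul_pow, abs_of_nonneg (Real.sqrt_nonneg _), Real.sq_sqrt (θ.nonneg _)]

theorem toL2_add (u v : WeightedL2 θ) : toL2 (u + v) = toL2 u + toL2 v := by
  ext n
  exact mul_add _ _ _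

theorem toL2_smul (c : ℂ) (u : WeightedL2 θ) : toL2 (c • u) = c • toL2 u := by
  ext n
  simp [toL2, mul_left_comm]

theorem toL2_eq_zero (u : WeightedL2 θ) (h : toL2 u = 0) : u = 0 := by
  refine Subtype.ext (funext fun n => ?_)
  have hn : (Real.sqrt (θ n) : ℂ) * u n = 0 := congrArg (fun w => w.1 n) h
  have hθ : (Real.sqrt (θ n) : ℂ) ≠ 0 := by
    exact_mod_cast (Real.sqrt_pos.2 (zero_lt_one.trans_le (θ.one_le n))).ne'
  exact (mul_eq_zero.1 hn).resolve_left hθ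

theorem normCore (θ : LatticeWeight) : NormedSpace.Core ℂ (WeightedL2 θ) where
  norm_nonneg u := Real.sqrt_nonneg _
  norm_smul c u := by rw [← norm_toL2, toL2_smul, norm_smul, norm_toL2]
  norm_triangle u v := by
    rw [← norm_toL2, ← norm_toL2 u, ← norm_toL2 v, toL2_add]
    exact norm_add_le _ _
  norm_eq_zero_iff u := by
    constructor
    · intro h
      rw [← norm_toL2, norm_eq_zero] at h
      exact toL2_eq_zero u h
    · rintro rfl
      simp [norm_def]

instance : NormedAddCommGroup (WeightedL2 θ) := NormedAddCommGroup.ofCore (normCore θ)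

instance : NormedSpace ℂ (WeightedL2 θ) := NormedSpace.ofCore (normCore θ)

end WeightedL2

/-- The finite-dimensional phase space on `|n| ≤ N`: the sequences which vanish for `|n| > N`,
with the norm `(∑_{|n| ≤ N} θ_n |v_n|²)^{1/2}`. It is `ℂ^{2N+1}` with the weighted Euclidean norm,
seen in `ℓ²_θ` by extension by zero; in particular `v_{-(N+1)} = v_{N+1} = 0`. -/
def truncatedSpace (θ : LatticeWeight) (N : ℕ) : Submodule ℂ (WeightedL2 θ) where
  carrier := {u | ∀ n : ℤ, (N : ℤ) < |n| → u n = 0}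
  zero_mem' := fun _ _ => rfl
  add_mem' := by
    intro u v hu hv n hn
    rw [WeightedL2.add_apply, hu n hn, hv n hn, add_zero]
  smul_mem' := by
    intro c u hu n hn
    rw [WeightedL2.smul_apply, hu n hn, mul_zero]

/-- The real parameters of the lattice equation and the exponent of its nonlinearity. -/
structure LatticeParams where
  α : ℝ
  β : ℝ
  γ : ℝ
  δ : ℝ
  η : ℝ
  ζ : ℝ
  p : ℝ

/-- The gauge nonlinearity `F(z) = |z|^{p-1} z`. -/
def gaugeF (p : ℝ) (z : ℂ) : ℂ := ((‖z‖ ^ (p - 1) : ℝ) : ℂ) * z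

/-- The left side, at the site `n`, of
`i u̇_n + (α+iβ)(u_{n-1} - 2u_n + u_{n+1}) + (γ+iδ) u_n + (η+iζ) F(u_n) = g_n`,
where `du` stands for `u̇`. -/
def latticeLHS (P : LatticeParams) (du u : ℤ → ℂ) (n : ℤ) : ℂ :=
  Complex.I * du n
    + ((P.α : ℂ) + Complex.I * (P.β : ℂ)) * (u (n - 1) - 2 * u n + u (n + 1))
    + ((P.γ : ℂ) + Complex.I * (P.δ : ℂ)) * u n
    + ((P.η : ℂ) + Complex.I * (P.ζ : ℂ)) * gaugeF P.p (u n)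

/-- `du` is the continuous derivative of `u` on `[0,∞)` (one-sided at `0`). -/
def IsC1DerivOn {E : Type*} [NormedAddCommGroup E] [NormedSpace ℝ E] (u du : ℝ → E) : Prop :=
  ContinuousOn du (Ici 0) ∧ ∀ t ∈ Ici (0 : ℝ), HasDerivWithinAt u (du t) (Ici 0) t

/-- `u ∈ C¹([0,∞), ℓ²_θ)` solves the equation on the infinite lattice. -/
def IsLatticeSolution {θ : LatticeWeight} (P : LatticeParams) (g : WeightedL2 θ)
    (u : ℝ → WeightedL2 θ) : Prop :=
  ∃ du : ℝ → WeightedL2 θ, IsC1DerivOn u du ∧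
    ∀ t ∈ Ici (0 : ℝ), ∀ n : ℤ, latticeLHS P (du t) (u t) n = g n

/-- `v ∈ C¹([0,∞), ℂ^{2N+1})` solves the equation at the sites `|n| ≤ N` with Dirichlet
boundary conditions. -/
def IsTruncatedSolution {θ : LatticeWeight} (P : LatticeParams) (g : WeightedL2 θ) (N : ℕ)
    (v : ℝ → truncatedSpace θ N) : Prop :=
  ∃ dv : ℝ → truncatedSpace θ N, IsC1DerivOn v dv ∧
    ∀ t ∈ Ici (0 : ℝ), ∀ n : ℤ, |n| ≤ (N : ℤ) →
      latticeLHS P (dv t : WeightedL2 θ) (v t : WeightedL2 θ) n = g n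

/-- `S t u₀` is the value at time `t` of a global solution which starts at `u₀`. -/
def IsSolutionSemigroup {E : Type*} (IsSol : (ℝ → E) → Prop) (S : ℝ≥0 → E → E) : Prop :=
  ∀ u₀ : E, S 0 u₀ = u₀ ∧ IsSol (fun t => S t.toNNReal u₀)

/-- The Hausdorff semidistance `d(B₁, B₂) = sup_{x ∈ B₁} inf_{y ∈ B₂} d(x, y)`. -/
def hausdorffSemidist {E : Type*} [PseudoEMetricSpace E] (B₁ B₂ : Set E) : ℝ≥0∞ :=
  ⨆ x ∈ B₁, ⨅ y ∈ B₂, edist x y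

/-- The global attractor of `S`: compact, invariant, and attracting all bounded sets. -/
structure IsGlobalAttractor {E : Type*} [PseudoMetricSpace E] (S : ℝ≥0 → E → E) (A : Set E) :
    Prop where
  isCompact : IsCompact A
  invariant : ∀ t : ℝ≥0, S t '' A = A
  attracts : ∀ B : Set E, Bornology.IsBounded B →
    Tendsto (fun t : ℝ≥0 => hausdorffSemidist (S t '' B) A) atTop (𝓝 0)

end

/-! Solved for the derivative, both systems are ODEs `u̇ = f u` on a Hilbert space with `f`
Lipschitz on balls. Pair `f u` with `u`: the terms in `γ` and `η` vanish, the `ζ` term has a good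
sign, and the `α` coupling, antisymmetric between neighbours, telescopes up to increments of the
weight. What remains is `⟪f u, u⟫ ≤ -σ‖u‖² + C`, with `σ` the quantity assumed positive. Hence
global solutions and a bounded absorbing ball.

Compactness comes from the same computation localized by a slowly varying cut-off
(`inner_mulBy_latticeField_le`). The error is `O(1/(K+1))`, so the part of an orbit beyond `K`
eventually becomes small uniformly on bounded sets, and the rest lives in finite dimension. The
ω-limit set of the absorbing ball is then the attractor.

Truncation is an orthogonal projection commuting with cut-offs (`inner_mulBy_truncation`), so the
finite systems obey the same inequalities with constants independent of `N`. All `A_N` thus lie in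
one ball and have uniformly small tails, and an orbit in `A_N` solves the infinite equation up to a
defect that vanishes as `N → ∞`. Choose a time `T` at which `S` has carried that ball close to `A`.
Each point of `A_N` is `S_N(T) w` with `w ∈ A_N`, and Gronwall places it near `S(T) w`, hence near
`A`. -/

noncomputable section

/-! ### Forward flows of dissipative vector fields. -/

section Flow

variable {H : Type*} [NormedAddCommGroup H] [InnerProductSpace ℝ H]

/-- `u` solves `u̇ = f(u)` on `[0,∞)`. -/
def IsForwardSolution (f : H → H) (u : ℝ → H) : Prop :=
  ∀ t ∈ Ici (0 : ℝ), HasDerivWithinAt u (f (u t)) (Ici 0) t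

/-- The retraction of a normed space onto the closed ball of radius `R` along rays. -/
def radialRetraction (R : ℝ) (u : H) : H := (R / max R ‖u‖) • u

theorem norm_radialRetraction_le {R : ℝ} (hR : 0 < R) (u : H) : ‖radialRetraction R u‖ ≤ R := by
  have hm : 0 < max R ‖u‖ := lt_max_of_lt_left hR
  rw [radialRetraction, norm_smul, Real.norm_of_nonneg (by positivity), div_mul_eq_mul_div,
    div_le_iff₀ hm]
  gcongr
  exact le_max_right _ _

theorem radialRetraction_of_norm_le {R : ℝ} (hR : 0 < R) {u : H} (hu : ‖u‖ ≤ R) :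
    radialRetraction R u = u := by
  rw [radialRetraction, max_eq_left hu, div_self hR.ne', one_smul]

/-- One unit of the constant comes from moving the vector, the other from the change of the scaling
factor; the sharp constant is not needed. -/
theorem lipschitzWith_radialRetraction {R : ℝ} (hR : 0 < R) :
    LipschitzWith 2 (radialRetraction R : H → H) := by
  refine LipschitzWith.of_dist_le_mul fun u v => ?_
  have hu : 0 < max R ‖u‖ := lt_max_of_lt_left hR
  have hv : 0 < max R ‖v‖ := lt_max_of_lt_left hR
  have key : radialRetraction R u - radialRetraction R v
      = (R / max R ‖u‖) • (u - v) + (R / max R ‖u‖ - R / max R ‖v‖) • v := by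
    simp only [radialRetraction, smul_sub, sub_smul]; abel
  have h1 : R / max R ‖u‖ ≤ 1 := (div_le_one hu).2 (le_max_left _ _)
  have h2 : ‖v‖ / max R ‖v‖ ≤ 1 := (div_le_one hv).2 (le_max_right _ _)
  have h3 : |max R ‖v‖ - max R ‖u‖| ≤ ‖u - v‖ := by
    refine (abs_max_sub_max_le_max R ‖v‖ R ‖u‖).trans ?_
    simpa [norm_sub_rev u v] using abs_norm_sub_norm_le v u
  have h4 : R / max R ‖u‖ - R / max R ‖v‖
      = (R / max R ‖u‖) * ((max R ‖v‖ - max R ‖u‖) / max R ‖v‖) := by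
    field_simp
  rw [dist_eq_norm, dist_eq_norm, key]
  refine (norm_add_le _ _).trans ?_
  rw [norm_smul, norm_smul, h4, norm_mul, Real.norm_of_nonneg (by positivity : 0 ≤ R / max R ‖u‖),
    norm_div, Real.norm_of_nonneg hv.le, Real.norm_eq_abs]
  have h5 : R / max R ‖u‖ * (|max R ‖v‖ - max R ‖u‖| / max R ‖v‖) * ‖v‖
      = (R / max R ‖u‖) * |max R ‖v‖ - max R ‖u‖| * (‖v‖ / max R ‖v‖) := by ring
  rw [h5]
  calc _ ≤ 1 * ‖u - v‖ + 1 * ‖u - v‖ * 1 := by gcongr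
    _ = _ := by push_cast; ring

variable {f : H → H}

theorem IsForwardSolution.continuousOn {u : ℝ → H} (hu : IsForwardSolution f u) :
    ContinuousOn u (Ici 0) := fun t ht => (hu t ht).continuousWithinAt

theorem IsForwardSolution.hasDerivWithinAt_Ici {u : ℝ → H} (hu : IsForwardSolution f u) {t : ℝ}
    (ht : 0 ≤ t) : HasDerivWithinAt u (f (u t)) (Ici t) t :=
  (hu t ht).mono (Ici_subset_Ici.2 ht)

/-- A bounded globally Lipschitz field has a forward solution through each point. -/
theorem exists_isForwardSolution_of_lipschitzWith [CompleteSpace H] {K : ℝ≥0}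
    (hf : LipschitzWith K f) {M : ℝ≥0} (hM : ∀ x, ‖f x‖ ≤ M) (u₀ : H) :
    ∃ u : ℝ → H, u 0 = u₀ ∧ IsForwardSolution f u := by
  have local_ex : ∀ n : ℕ, ∃ u : ℝ → H, u 0 = u₀ ∧
      ∀ t ∈ Icc (0 : ℝ) n, HasDerivWithinAt u (f (u t)) (Icc 0 n) t := by
    intro n
    -- A field bounded by `M` cannot leave the ball of radius `M * n` before time `n`, so
    -- Picard–Lindelöf covers the whole interval.
    have hpl : IsPicardLindelof (fun _ => f) (⟨0, le_rfl, n.cast_nonneg⟩ : Icc (0 : ℝ) n) u₀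
        (M * n) 0 M K :=
      { lipschitzOnWith := fun _ _ => hf.lipschitzOnWith
        continuousOn := fun _ _ => continuousOn_const
        norm_le := fun _ _ x _ => hM x
        mul_max_le := by simp }
    exact hpl.exists_eq_forall_mem_Icc_hasDerivWithinAt₀
  choose w hw0 hw using local_ex
  have agree : ∀ m n : ℕ, m ≤ n → ∀ t ∈ Icc (0 : ℝ) m, w m t = w n t := by
    intro m n hmn
    have hmn' : (m : ℝ) ≤ n := by exact_mod_cast hmn
    have hder : ∀ k : ℕ, m ≤ k → ∀ t ∈ Ico (0 : ℝ) m,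
        HasDerivWithinAt (w k) (f (w k t)) (Ici t) t := by
      intro k hk t ht
      have hk' : (m : ℝ) ≤ k := by exact_mod_cast hk
      refine (hw k t ⟨ht.1, ht.2.le.trans hk'⟩).mono_of_mem_nhdsWithin ?_
      exact mem_of_superset (Icc_mem_nhdsGE (ht.2.trans_le hk')) (Icc_subset_Icc_left ht.1)
    have hcont : ∀ k : ℕ, m ≤ k → ContinuousOn (w k) (Icc 0 m) := by
      intro k hk
      have hk' : (m : ℝ) ≤ k := by exact_mod_cast hk
      exact ContinuousOn.mono (fun t ht => (hw k t ht).continuousWithinAt)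
        (Icc_subset_Icc_right hk')
    exact ODE_solution_unique_of_mem_Icc_right (v := fun _ => f) (s := fun _ => univ) (K := K)
      (fun _ _ => hf.lipschitzOnWith) (hcont m le_rfl) (hder m le_rfl) (fun _ _ => mem_univ _)
      (hcont n hmn) (hder n hmn) (fun _ _ => mem_univ _) ((hw0 m).trans (hw0 n).symm)
  -- The index strictly exceeds `t`, so by `agree` the glued curve coincides near each time with a
  -- single `w n`.
  let u : ℝ → H := fun t => w (⌊t⌋₊ + 1) t
  have hu : ∀ n : ℕ, ∀ t : ℝ, 0 ≤ t → t < n → u t = w n t := by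
    intro n t ht htn
    refine agree _ _ ?_ t ⟨ht, ?_⟩
    · exact Nat.succ_le_of_lt ((Nat.floor_lt ht).2 htn)
    · push_cast; exact (Nat.lt_floor_add_one t).le
  refine ⟨u, by simpa [u] using hw0 1, fun t ht => ?_⟩
  obtain ⟨n, hn⟩ := exists_nat_gt t
  have hderiv := (hw n t ⟨ht, hn.le⟩)
  have hmem : Icc (0 : ℝ) n ∈ 𝓝[Ici 0] t := by
    rw [← Ici_inter_Iic]
    exact inter_mem self_mem_nhdsWithin (mem_nhdsWithin_of_mem_nhds (Iic_mem_nhds hn))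
  rw [hu n t ht hn]
  refine (hderiv.mono_of_mem_nhdsWithin hmem).congr_of_eventuallyEq ?_ (hu n t ht hn)
  filter_upwards [self_mem_nhdsWithin, mem_nhdsWithin_of_mem_nhds (Iio_mem_nhds hn)] with s hs hs'
  exact hu n s hs hs'

/-- A field which is Lipschitz on balls and satisfies `⟪f(u), u⟫ ≤ -σ‖u‖² + C`. -/
structure IsDissipativeField (f : H → H) (σ C : ℝ) : Prop where
  lipschitz : ∀ R : ℝ, ∃ K : ℝ≥0, LipschitzOnWith K f (Metric.closedBall 0 R)
  rate_pos : 0 < σ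
  inner_le : ∀ u : H, inner ℝ (f u) u ≤ -σ * ‖u‖ ^ 2 + C

theorem IsForwardSolution.hasDerivWithinAt_norm_sq {u : ℝ → H} (hu : IsForwardSolution f u)
    {H' : Type*} [NormedAddCommGroup H'] [InnerProductSpace ℝ H'] (Q : H →L[ℝ] H') {t : ℝ}
    (ht : 0 ≤ t) :
    HasDerivWithinAt (fun s => ‖Q (u s)‖ ^ 2) (2 * inner ℝ (Q (f (u t))) (Q (u t))) (Ici t) t := by
  have h := (Q.hasFDerivAt.comp_hasDerivWithinAt t (hu.hasDerivWithinAt_Ici ht)).norm_sq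
  rw [real_inner_comm]
  exact h

/-- Exponential decay of a quadratic functional along a solution. -/
theorem IsForwardSolution.norm_sq_le {u : ℝ → H} (hu : IsForwardSolution f u)
    {H' : Type*} [NormedAddCommGroup H'] [InnerProductSpace ℝ H'] (Q : H →L[ℝ] H') {σ C : ℝ}
    (hσ : 0 < σ) (hC : 0 ≤ C)
    (h : ∀ t, 0 ≤ t → inner ℝ (Q (f (u t))) (Q (u t)) ≤ -σ * ‖Q (u t)‖ ^ 2 + C) {t : ℝ}
    (ht : 0 ≤ t) :
    ‖Q (u t)‖ ^ 2 ≤ Real.exp (-(2 * σ) * t) * ‖Q (u 0)‖ ^ 2 + C / σ := by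
  have hcont : ContinuousOn (fun s => ‖Q (u s)‖ ^ 2) (Icc 0 t) := by
    have := hu.continuousOn.mono (Icc_subset_Ici_self : Icc 0 t ⊆ Ici 0)
    fun_prop
  -- Gronwall with the negative rate `-2σ`; the forcing `2C` then contributes at most `C / σ`.
  have key := le_gronwallBound_of_liminf_deriv_right_le (f := fun s => ‖Q (u s)‖ ^ 2)
    (f' := fun s => 2 * inner ℝ (Q (f (u s))) (Q (u s))) (δ := ‖Q (u 0)‖ ^ 2) (K := -(2 * σ))
    (ε := 2 * C) hcont
    (fun s hs r hr => (hu.hasDerivWithinAt_norm_sq Q hs.1).liminf_right_slope_le hr) le_rfl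
    (fun s hs => by have := h s hs.1; linarith) t ⟨ht, le_rfl⟩
  rw [gronwallBound_of_K_ne_0 (by linarith), sub_zero] at key
  refine key.trans ?_
  have h2 : 2 * C / -(2 * σ) = -(C / σ) := by field_simp
  rw [h2]
  have h3 : 0 ≤ C / σ * Real.exp (-(2 * σ) * t) := by positivity
  linarith

namespace IsDissipativeField

variable {σ C : ℝ}

theorem const_nonneg (hf : IsDissipativeField f σ C) : 0 ≤ C := by
  simpa using hf.inner_le 0

theorem continuous (hf : IsDissipativeField f σ C) : Continuous f := by
  refine continuous_iff_continuousAt.2 fun x => ?_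
  obtain ⟨K, hK⟩ := hf.lipschitz (‖x‖ + 1)
  refine hK.continuousOn.continuousAt ?_
  exact mem_of_superset (Metric.isOpen_ball.mem_nhds (by simp)) Metric.ball_subset_closedBall

theorem norm_sq_le (hf : IsDissipativeField f σ C) {u : ℝ → H} (hu : IsForwardSolution f u)
    {t : ℝ} (ht : 0 ≤ t) :
    ‖u t‖ ^ 2 ≤ Real.exp (-(2 * σ) * t) * ‖u 0‖ ^ 2 + C / σ :=
  hu.norm_sq_le (ContinuousLinearMap.id ℝ H) hf.rate_pos hf.const_nonneg
    (fun s _ => hf.inner_le (u s)) ht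

theorem norm_le (hf : IsDissipativeField f σ C) {u : ℝ → H} (hu : IsForwardSolution f u)
    {t R : ℝ} (ht : 0 ≤ t) (hR : ‖u 0‖ ≤ R) : ‖u t‖ ≤ Real.sqrt (R ^ 2 + C / σ) := by
  refine Real.le_sqrt_of_sq_le ((hf.norm_sq_le hu ht).trans ?_)
  have h1 : Real.exp (-(2 * σ) * t) ≤ 1 := by
    rw [Real.exp_le_one_iff]
    nlinarith [hf.rate_pos]
  have h2 : ‖u 0‖ ^ 2 ≤ R ^ 2 := by gcongr
  nlinarith [sq_nonneg ‖u 0‖, Real.exp_pos (-(2 * σ) * t)]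

/-- Two solutions diverge at most exponentially, at a rate uniform on bounded sets; here the
second one may be approximate. -/
theorem exists_dist_le (hf : IsDissipativeField f σ C) (R : ℝ) :
    ∃ K : ℝ≥0, ∀ (u v v' : ℝ → H) (ε : ℝ), IsForwardSolution f u →
      (∀ t, 0 ≤ t → HasDerivWithinAt v (v' t) (Ici 0) t) →
      (∀ t, 0 ≤ t → dist (v' t) (f (v t)) ≤ ε) → ‖u 0‖ ≤ R →
      (∀ t, 0 ≤ t → ‖v t‖ ≤ Real.sqrt (R ^ 2 + C / σ)) →
      ∀ t, 0 ≤ t → dist (u t) (v t) ≤ gronwallBound (dist (u 0) (v 0)) K ε t := by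
  -- Dissipativity confines `u` to this ball for all time, so one Lipschitz constant serves. An
  -- approximate `v` has no such guarantee, whence the assumption on its norm.
  obtain ⟨K, hK⟩ := hf.lipschitz (Real.sqrt (R ^ 2 + C / σ))
  refine ⟨K, fun u v v' ε hu hv hvε huR hvR t ht => ?_⟩
  have hcv : ContinuousOn v (Ici 0) := fun s hs => (hv s hs).continuousWithinAt
  have := dist_le_of_approx_trajectories_ODE_of_mem (v := fun _ => f)
    (s := fun _ => Metric.closedBall 0 (Real.sqrt (R ^ 2 + C / σ))) (K := K) (f := u) (g := v)
    (a := 0) (b := t) (f' := fun s => f (u s)) (g' := v') (εf := 0) (εg := ε)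
    (δ := dist (u 0) (v 0)) (fun _ _ => hK)
    (hu.continuousOn.mono Icc_subset_Ici_self) (fun s hs => hu.hasDerivWithinAt_Ici hs.1)
    (fun s _ => (dist_self _).le) (fun s hs => by simpa using hf.norm_le hu hs.1 huR)
    (hcv.mono Icc_subset_Ici_self) (fun s hs => (hv s hs.1).mono (Ici_subset_Ici.2 hs.1))
    (fun s hs => hvε s hs.1) (fun s hs => by simpa using hvR s hs.1) le_rfl t ⟨ht, le_rfl⟩
  simpa using this

theorem exists_dist_le_exp (hf : IsDissipativeField f σ C) (R : ℝ) :
    ∃ K : ℝ≥0, ∀ u v : ℝ → H, IsForwardSolution f u → IsForwardSolution f v →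
      ‖u 0‖ ≤ R → ‖v 0‖ ≤ R → ∀ t, 0 ≤ t →
      dist (u t) (v t) ≤ dist (u 0) (v 0) * Real.exp (K * t) := by
  obtain ⟨K, hK⟩ := hf.exists_dist_le R
  refine ⟨K, fun u v hu hv huR hvR t ht => ?_⟩
  simpa [gronwallBound_ε0] using hK u v (fun s => f (v s)) 0 hu hv (fun s _ => (dist_self _).le) huR
    (fun s hs => hf.norm_le hv hs hvR) t ht

theorem eqOn_of_eq (hf : IsDissipativeField f σ C) {u v : ℝ → H} (hu : IsForwardSolution f u)
    (hv : IsForwardSolution f v) (h : u 0 = v 0) {t : ℝ} (ht : 0 ≤ t) : u t = v t := by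
  obtain ⟨K, hK⟩ := hf.exists_dist_le_exp ‖u 0‖
  refine dist_le_zero.1 ((hK u v hu hv le_rfl (by rw [h]) t ht).trans ?_)
  simp [h]

/-- Composing `f` with the retraction makes it bounded and globally Lipschitz. On the sphere of
radius `R` the field points strictly inward because `C < σR²`, so the solution never leaves the ball
and never sees the modification. -/
theorem exists_isForwardSolution [CompleteSpace H] (hf : IsDissipativeField f σ C) (u₀ : H) :
    ∃ u : ℝ → H, u 0 = u₀ ∧ IsForwardSolution f u := by
  -- The summand `1` gives `R ≥ 1`, hence `R² ≥ R > C / σ`.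
  set R : ℝ := ‖u₀‖ + C / σ + 1 with hRdef
  have hCσ : 0 ≤ C / σ := div_nonneg hf.const_nonneg hf.rate_pos.le
  have hR : 0 < R := by positivity
  have hR1 : 1 ≤ R := by have := norm_nonneg u₀; linarith
  obtain ⟨K, hK⟩ := hf.lipschitz R
  have hmaps : ∀ x, radialRetraction R x ∈ Metric.closedBall (0 : H) R := fun x => by
    simpa using norm_radialRetraction_le hR x
  have hlip : LipschitzWith (K * 2) (fun x => f (radialRetraction R x)) := by
    rw [← lipschitzOnWith_univ]
    exact hK.comp (lipschitzWith_radialRetraction hR).lipschitzOnWith fun x _ => hmaps x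
  have hbd : ∀ x, ‖f (radialRetraction R x)‖ ≤ (‖f 0‖₊ + K * R.toNNReal : ℝ≥0) := by
    intro x
    have h1 := hK.dist_le_mul _ (hmaps x) 0 (by simpa using hR.le)
    rw [dist_eq_norm, dist_zero_right] at h1
    have h2 := norm_le_norm_add_norm_sub' (f (radialRetraction R x)) (f 0)
    have h3 := norm_radialRetraction_le hR x
    push_cast
    rw [Real.coe_toNNReal _ hR.le]
    have : (K : ℝ) * ‖radialRetraction R x‖ ≤ K * R := by gcongr
    linarith
  obtain ⟨u, hu0, hu⟩ := exists_isForwardSolution_of_lipschitzWith hlip hbd u₀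
  have hstay : ∀ t, 0 ≤ t → ‖u t‖ ≤ R := by
    intro t ht
    have hcont : ContinuousOn (fun s => ‖u s‖ ^ 2) (Icc 0 t) := by
      have := hu.continuousOn.mono (Icc_subset_Ici_self : Icc 0 t ⊆ Ici 0)
      fun_prop
    have hle : ‖u t‖ ^ 2 ≤ R ^ 2 := by
      refine image_le_of_deriv_right_lt_deriv_boundary' (f := fun s => ‖u s‖ ^ 2)
        (B := fun _ => R ^ 2) (B' := fun _ => 0) hcont
        (fun s hs => hu.hasDerivWithinAt_norm_sq (ContinuousLinearMap.id ℝ H) hs.1) ?_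
        continuousOn_const (fun s _ => hasDerivWithinAt_const _ _ _) ?_ ⟨ht, le_rfl⟩
      · simp only [hu0]
        gcongr
        linarith
      · intro s hs hsR
        have hsR' : ‖u s‖ = R := (pow_left_inj₀ (norm_nonneg _) hR.le two_ne_zero).1 hsR
        have h1 := hf.inner_le (u s)
        simp only [ContinuousLinearMap.coe_id', id, radialRetraction_of_norm_le hR hsR'.le]
        rw [hsR'] at h1
        have h2 : C < σ * R ^ 2 := by
          have h3 : C / σ < R ^ 2 := by nlinarith [norm_nonneg u₀]
          rwa [div_lt_iff₀ hf.rate_pos, mul_comm] at h3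
        linarith
    exact (pow_le_pow_iff_left₀ (norm_nonneg _) hR.le two_ne_zero).1 hle
  refine ⟨u, hu0, fun t ht => ?_⟩
  simpa only [radialRetraction_of_norm_le hR (hstay t ht)] using hu t ht

end IsDissipativeField

end Flow

end

noncomputable section

/-! ### The Hausdorff semidistance in terms of `ε`. -/

section Semidistance

variable {X : Type*} [PseudoMetricSpace X]

theorem hausdorffSemidist_le {B A : Set X} {ε : ℝ≥0∞}
    (h : ∀ x ∈ B, ∃ y ∈ A, edist x y ≤ ε) : hausdorffSemidist B A ≤ ε := by
  refine iSup₂_le fun x hx => ?_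
  obtain ⟨y, hy, hxy⟩ := h x hx
  exact (iInf₂_le y hy).trans hxy

theorem exists_edist_lt_of_hausdorffSemidist_lt {B A : Set X} {ε : ℝ≥0∞}
    (h : hausdorffSemidist B A < ε) {x : X} (hx : x ∈ B) : ∃ y ∈ A, edist x y < ε := by
  have h1 : ⨅ y ∈ A, edist x y < ε :=
    (le_iSup₂ (f := fun x (_ : x ∈ B) => ⨅ y ∈ A, edist x y) x hx).trans_lt h
  simpa [iInf_lt_iff] using h1

theorem tendsto_hausdorffSemidist_zero {ι : Type*} {l : Filter ι} {B : ι → Set X} {A : Set X}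
    (h : ∀ ε : ℝ, 0 < ε → ∀ᶠ i in l, ∀ x ∈ B i, ∃ y ∈ A, dist x y ≤ ε) :
    Tendsto (fun i => hausdorffSemidist (B i) A) l (𝓝 0) := by
  refine ENNReal.tendsto_nhds_zero.2 fun ε hε => ?_
  obtain ⟨δ, hδ, hδε⟩ : ∃ δ : ℝ, 0 < δ ∧ ENNReal.ofReal δ ≤ ε := by
    obtain ⟨r, hr0, hr⟩ := ENNReal.lt_iff_exists_nnreal_btwn.1 hε
    exact ⟨r, by exact_mod_cast hr0, by simpa using hr.le⟩
  filter_upwards [h δ hδ] with i hi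
  refine hausdorffSemidist_le fun x hx => ?_
  obtain ⟨y, hy, hxy⟩ := hi x hx
  exact ⟨y, hy, by rw [edist_dist]; exact (ENNReal.ofReal_le_ofReal hxy).trans hδε⟩

theorem eventually_exists_dist_lt {ι : Type*} {l : Filter ι} {B : ι → Set X} {A : Set X}
    (h : Tendsto (fun i => hausdorffSemidist (B i) A) l (𝓝 0)) {ε : ℝ} (hε : 0 < ε) :
    ∀ᶠ i in l, ∀ x ∈ B i, ∃ y ∈ A, dist x y < ε := by
  filter_upwards [h.eventually_lt_const (ENNReal.ofReal_pos.2 hε)] with i hi x hx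
  obtain ⟨y, hy, hxy⟩ := exists_edist_lt_of_hausdorffSemidist_lt hi hx
  exact ⟨y, hy, by rwa [edist_dist, ENNReal.ofReal_lt_ofReal_iff hε] at hxy⟩

end Semidistance

/-! ### Existence and uniqueness of global attractors for abstract semigroups. -/

section Attractor

variable {X : Type*} [MetricSpace X]

/-- A continuous semigroup with a bounded absorbing set. -/
structure IsDissipativeSemigroup (S : ℝ≥0 → X → X) (B : Set X) : Prop where
  map_zero : ∀ x, S 0 x = x
  map_add : ∀ s t x, S (s + t) x = S s (S t x)
  continuous : ∀ t, Continuous (S t)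
  isBounded : Bornology.IsBounded B
  absorbs : ∀ B', Bornology.IsBounded B' → ∃ T, ∀ t, T ≤ t → S t '' B' ⊆ B

/-- Orbits of bounded sets approach compact sets to within any positive distance. -/
def IsAsymptoticallyCompact (S : ℝ≥0 → X → X) : Prop :=
  ∀ B, Bornology.IsBounded B → ∀ ε : ℝ, 0 < ε →
    ∃ K : Set X, IsCompact K ∧ ∃ T, ∀ t, T ≤ t → ∀ x ∈ B, ∃ y ∈ K, dist (S t x) y ≤ ε

variable {S : ℝ≥0 → X → X} {B : Set X}

/-- Late terms are uniformly close to a compact set and only finitely many terms are early, so the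
sequence has totally bounded range. -/
theorem IsAsymptoticallyCompact.exists_tendsto_subseq [CompleteSpace X]
    (hS : IsAsymptoticallyCompact S) (hB : Bornology.IsBounded B) {t : ℕ → ℝ≥0} {x : ℕ → X}
    (ht : Tendsto t atTop atTop) (hx : ∀ n, x n ∈ B) :
    ∃ y, ∃ φ : ℕ → ℕ, StrictMono φ ∧ Tendsto (fun n => S (t (φ n)) (x (φ n))) atTop (𝓝 y) := by
  have htb : TotallyBounded (range fun n => S (t n) (x n)) := by
    refine Metric.totallyBounded_iff.2 fun ε hε => ?_
    obtain ⟨K, hK, T, hT⟩ := hS B hB (ε / 2 / 2) (by positivity)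
    obtain ⟨F, hF, hKF⟩ := Metric.totallyBounded_iff.1 hK.totallyBounded (ε / 2) (by positivity)
    obtain ⟨n₀, hn₀⟩ := eventually_atTop.1 (ht.eventually_ge_atTop T)
    refine ⟨F ∪ (fun n => S (t n) (x n)) '' Iio n₀, hF.union ((finite_Iio n₀).image _), ?_⟩
    rintro _ ⟨n, rfl⟩
    rcases lt_or_ge n n₀ with hn | hn
    · exact mem_iUnion₂.2 ⟨_, Or.inr ⟨n, hn, rfl⟩, Metric.mem_ball_self hε⟩
    · obtain ⟨y, hy, hxy⟩ := hT (t n) (hn₀ n hn) (x n) (hx n)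
      obtain ⟨z, hz, hyz⟩ := mem_iUnion₂.1 (hKF hy)
      refine mem_iUnion₂.2 ⟨z, Or.inl hz, ?_⟩
      rw [Metric.mem_ball] at hyz ⊢
      have := dist_triangle (S (t n) (x n)) y z
      linarith
  have hc : IsCompact (closure (range fun n => S (t n) (x n))) :=
    htb.closure.isCompact_of_isClosed isClosed_closure
  obtain ⟨y, -, φ, hφ, hy⟩ := hc.tendsto_subseq (fun n => subset_closure (mem_range_self n))
  exact ⟨y, φ, hφ, hy⟩

/-- The `ω`-limit set of `B`, described by sequences. -/
def omegaLimitSet (S : ℝ≥0 → X → X) (B : Set X) : Set X :=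
  {y | ∃ (t : ℕ → ℝ≥0) (x : ℕ → X), Tendsto t atTop atTop ∧ (∀ n, x n ∈ B) ∧
    Tendsto (fun n => S (t n) (x n)) atTop (𝓝 y)}

theorem exists_dist_le_of_mem_omegaLimitSet {y : X} (hy : y ∈ omegaLimitSet S B) (k : ℕ) :
    ∃ t : ℝ≥0, (k : ℝ≥0) ≤ t ∧ ∃ x ∈ B, dist (S t x) y ≤ 1 / ((k : ℝ) + 1) := by
  obtain ⟨t, x, ht, hx, hxy⟩ := hy
  have h1 : ∀ᶠ n in atTop, dist (S (t n) (x n)) y < 1 / ((k : ℝ) + 1) :=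
    (tendsto_iff_dist_tendsto_zero.1 hxy).eventually_lt_const (by positivity)
  obtain ⟨n, hn1, hn2⟩ := (h1.and (ht.eventually_ge_atTop (k : ℝ≥0))).exists
  exact ⟨t n, hn2, x n, hx n, hn1.le⟩

/-- Each of the three properties reduces to extracting a convergent subsequence of `S (t n) (x n)`
with `t n → ∞` and `x n` in the absorbing set. -/
theorem IsDissipativeSemigroup.isGlobalAttractor_omegaLimitSet [CompleteSpace X]
    (hS : IsDissipativeSemigroup S B) (hac : IsAsymptoticallyCompact S) :
    IsGlobalAttractor S (omegaLimitSet S B) where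
  isCompact := by
    refine IsSeqCompact.isCompact fun y hy => ?_
    -- Diagonal choice: each `y k` is replaced by an orbit point at time at least `k`, within
    -- `1/(k+1)` of it.
    choose t ht x hx hxy using fun k => exists_dist_le_of_mem_omegaLimitSet (hy k) k
    have ht' : Tendsto t atTop atTop := tendsto_atTop_mono ht tendsto_natCast_atTop_atTop
    obtain ⟨z, φ, hφ, hz⟩ := hac.exists_tendsto_subseq hS.isBounded ht' hx
    refine ⟨z, ⟨t ∘ φ, x ∘ φ, ht'.comp hφ.tendsto_atTop, fun n => hx _, hz⟩, φ, hφ, ?_⟩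
    have h0 : Tendsto (fun n => dist (S (t (φ n)) (x (φ n))) (y (φ n))) atTop (𝓝 0) :=
      squeeze_zero (fun _ => dist_nonneg) (fun n => hxy (φ n))
        (tendsto_one_div_add_atTop_nhds_zero_nat.comp hφ.tendsto_atTop)
    exact (tendsto_iff_of_dist h0).1 hz
  invariant := by
    intro s
    refine Subset.antisymm ?_ ?_
    · rintro _ ⟨y, ⟨t, x, ht, hx, hxy⟩, rfl⟩
      refine ⟨fun n => s + t n, x, tendsto_atTop_mono (fun n => le_add_self) ht, hx, ?_⟩
      simp only [hS.map_add]
      exact ((hS.continuous s).tendsto y).comp hxy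
    · rintro y ⟨t, x, ht, hx, hxy⟩
      have ht' : Tendsto (fun n => t n - s) atTop atTop := by
        refine tendsto_atTop.2 fun b => ?_
        filter_upwards [ht.eventually_ge_atTop (b + s)] with n hn
        exact le_tsub_of_add_le_right hn
      obtain ⟨z, φ, hφ, hz⟩ := hac.exists_tendsto_subseq hS.isBounded ht' hx
      refine ⟨z, ⟨_, x ∘ φ, ht'.comp hφ.tendsto_atTop, fun n => hx _, hz⟩, ?_⟩
      have h1 := ((hS.continuous s).tendsto z).comp hz
      refine tendsto_nhds_unique (h1.congr' ?_) (hxy.comp hφ.tendsto_atTop)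
      filter_upwards [(ht.comp hφ.tendsto_atTop).eventually_ge_atTop s] with n hn
      simp only [Function.comp_apply] at hn ⊢
      rw [← hS.map_add, add_tsub_cancel_of_le hn]
  attracts := by
    intro B' hB'
    refine tendsto_hausdorffSemidist_zero fun ε hε => ?_
    by_contra hcon
    have hfreq : ∀ k : ℕ, ∃ t : ℝ≥0, (k : ℝ≥0) ≤ t ∧ ∃ x ∈ B', ∀ y ∈ omegaLimitSet S B,
        ε < dist (S t x) y := by
      intro k
      rw [not_eventually] at hcon
      obtain ⟨t, ht, hk⟩ := (hcon.and_eventually (eventually_ge_atTop (k : ℝ≥0))).exists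
      push Not at ht
      obtain ⟨_, ⟨x, hx, rfl⟩, h⟩ := ht
      exact ⟨t, hk, x, hx, h⟩
    choose t ht x hx hfar using hfreq
    have ht' : Tendsto t atTop atTop := tendsto_atTop_mono ht tendsto_natCast_atTop_atTop
    obtain ⟨T, hT⟩ := hS.absorbs B' hB'
    have ht'' : Tendsto (fun n => t n - T) atTop atTop := by
      refine tendsto_atTop.2 fun b => ?_
      filter_upwards [ht'.eventually_ge_atTop (b + T)] with n hn
      exact le_tsub_of_add_le_right hn
    -- A fixed time `T` moves `B'` into `B`, and the remaining time `t n - T` still tends to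
    -- infinity, so the limit lies in the ω-limit set of `B` itself.
    have hxB : ∀ n, S T (x n) ∈ B := fun n => hT T le_rfl ⟨x n, hx n, rfl⟩
    obtain ⟨z, φ, hφ, hz⟩ := hac.exists_tendsto_subseq hS.isBounded ht'' hxB
    have hzA : z ∈ omegaLimitSet S B := ⟨_, _, ht''.comp hφ.tendsto_atTop, fun n => hxB (φ n), hz⟩
    have h1 : ∀ᶠ n in atTop, dist (S (t (φ n) - T) (S T (x (φ n)))) z < ε :=
      (tendsto_iff_dist_tendsto_zero.1 hz).eventually_lt_const hε
    obtain ⟨n, hn1, hn2⟩ :=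
      (h1.and ((ht'.comp hφ.tendsto_atTop).eventually_ge_atTop T)).exists
    have hn3 : T ≤ t (φ n) := hn2
    rw [← hS.map_add, tsub_add_cancel_of_le hn3] at hn1
    exact lt_asymm hn1 (hfar (φ n) z hzA)

/-- `A` is bounded and equal to its own image, so being attracted by `A'` puts it in the closure of
`A'`, which is `A'`. -/
theorem IsGlobalAttractor.subset {A A' : Set X} (hA : IsGlobalAttractor S A)
    (hA' : IsGlobalAttractor S A') : A ⊆ A' := by
  intro x hx
  rw [← hA'.isCompact.isClosed.closure_eq, Metric.mem_closure_iff]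
  intro ε hε
  obtain ⟨t, ht⟩ := (eventually_exists_dist_lt (hA'.attracts A hA.isCompact.isBounded) hε).exists
  rw [hA.invariant t] at ht
  exact ht x hx

theorem IsGlobalAttractor.unique {A A' : Set X} (hA : IsGlobalAttractor S A)
    (hA' : IsGlobalAttractor S A') : A = A' :=
  (hA.subset hA').antisymm (hA'.subset hA)

theorem IsDissipativeSemigroup.existsUnique_isGlobalAttractor [CompleteSpace X]
    (hS : IsDissipativeSemigroup S B) (hac : IsAsymptoticallyCompact S) :
    ∃! A : Set X, IsGlobalAttractor S A :=
  ⟨_, hS.isGlobalAttractor_omegaLimitSet hac,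
    fun _ hA => hA.unique (hS.isGlobalAttractor_omegaLimitSet hac)⟩

theorem IsDissipativeSemigroup.isAsymptoticallyCompact_of_properSpace [ProperSpace X]
    (hS : IsDissipativeSemigroup S B) : IsAsymptoticallyCompact S := by
  intro B' hB' ε hε
  obtain ⟨T, hT⟩ := hS.absorbs B' hB'
  exact ⟨closure B, hS.isBounded.isCompact_closure, T, fun t ht x hx =>
    ⟨S t x, subset_closure (hT t ht ⟨x, hx, rfl⟩), by simpa using hε.le⟩⟩

end Attractor

/-! ### The solution semigroup of a dissipative field. -/

section SolutionSemigroup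

variable {H : Type*} [NormedAddCommGroup H] [InnerProductSpace ℝ H] {f : H → H} {σ C : ℝ}
  {S : ℝ≥0 → H → H}

namespace IsDissipativeField

theorem existsUnique_isSolutionSemigroup [CompleteSpace H] (hf : IsDissipativeField f σ C) :
    ∃! S : ℝ≥0 → H → H, IsSolutionSemigroup (IsForwardSolution f) S := by
  choose u hu0 hu using hf.exists_isForwardSolution
  -- Values at negative times are irrelevant to one-sided derivatives on `[0,∞)`, so they may be
  -- frozen.
  have hext : ∀ u₀, IsForwardSolution f (fun t : ℝ => u u₀ t.toNNReal) := by
    intro u₀ t ht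
    have h := hu u₀ t ht
    have heq : ∀ s ∈ Ici (0 : ℝ), u u₀ s.toNNReal = u u₀ s := fun s hs => by
      rw [Real.coe_toNNReal s hs]
    simp only [heq t ht]
    exact h.congr heq (heq t ht)
  refine ⟨fun t u₀ => u u₀ t, fun u₀ => ⟨by simpa using hu0 u₀, hext u₀⟩, fun S hS => ?_⟩
  funext t u₀
  have h := hf.eqOn_of_eq (hS u₀).2 (hu u₀) (by simpa [hu0 u₀] using (hS u₀).1) t.coe_nonneg
  simpa using h

theorem norm_sq_semigroup_le (hf : IsDissipativeField f σ C)
    (hS : IsSolutionSemigroup (IsForwardSolution f) S) (t : ℝ≥0) (x : H) :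
    ‖S t x‖ ^ 2 ≤ Real.exp (-(2 * σ) * t) * ‖x‖ ^ 2 + C / σ := by
  simpa [(hS x).1] using hf.norm_sq_le (hS x).2 t.coe_nonneg

theorem semigroup_add (hf : IsDissipativeField f σ C)
    (hS : IsSolutionSemigroup (IsForwardSolution f) S) (s t : ℝ≥0) (x : H) :
    S (s + t) x = S s (S t x) := by
  have hshift : IsForwardSolution f (fun r : ℝ => S (r + t).toNNReal x) := by
    intro r hr
    have hr' : (0 : ℝ) ≤ r := hr
    have h := ((hS x).2 (r + t) (by positivity : (0 : ℝ) ≤ r + t)).scomp r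
      (h := fun r : ℝ => r + t) ((hasDerivWithinAt_id r (Ici 0)).add_const (t : ℝ))
      (fun y hy => add_nonneg hy t.coe_nonneg)
    simpa [Function.comp_def] using h
  have h := hf.eqOn_of_eq hshift (hS (S t x)).2 (by simp [(hS (S t x)).1]) s.coe_nonneg
  simpa [Real.toNNReal_add] using h

/-- The `1` in the radius is slack for the decaying exponential; continuity in the initial value is
the Gronwall bound on a ball around it. -/
theorem isDissipativeSemigroup (hf : IsDissipativeField f σ C)
    (hS : IsSolutionSemigroup (IsForwardSolution f) S) :
    IsDissipativeSemigroup S (Metric.closedBall 0 (Real.sqrt (1 + C / σ))) where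
  map_zero x := (hS x).1
  map_add := hf.semigroup_add hS
  isBounded := Metric.isBounded_closedBall
  continuous t := by
    refine continuous_iff_continuousAt.2 fun x => ?_
    obtain ⟨K, hK⟩ := hf.exists_dist_le_exp (‖x‖ + 1)
    refine tendsto_iff_dist_tendsto_zero.2 ?_
    have hlim : Tendsto (fun y => dist y x * Real.exp (K * t)) (𝓝 x) (𝓝 0) := by
      have : Tendsto (fun y => dist y x) (𝓝 x) (𝓝 0) := tendsto_iff_dist_tendsto_zero.1 tendsto_id
      simpa using this.mul_const (Real.exp (K * t))
    refine squeeze_zero' (Eventually.of_forall fun _ => dist_nonneg) ?_ hlim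
    filter_upwards [Metric.ball_mem_nhds x one_pos] with y hy
    have hy' : ‖y‖ ≤ ‖x‖ + 1 := by
      have := norm_le_norm_add_norm_sub' y x
      rw [Metric.mem_ball, dist_eq_norm] at hy
      linarith
    have := hK _ _ (hS y).2 (hS x).2 (by simpa [(hS y).1] using hy') (by simp [(hS x).1]) t
      t.coe_nonneg
    simpa [(hS x).1, (hS y).1] using this
  absorbs B hB := by
    obtain ⟨R, hR⟩ := hB.exists_norm_le
    have hlim : Tendsto (fun t : ℝ≥0 => Real.exp (-(2 * σ) * t) * R ^ 2) atTop (𝓝 0) := by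
      have h1 : Tendsto (fun t : ℝ≥0 => -(2 * σ) * (t : ℝ)) atTop atBot :=
        (NNReal.tendsto_coe_atTop.2 tendsto_id).const_mul_atTop_of_neg (by linarith [hf.rate_pos])
      simpa using (Real.tendsto_exp_atBot.comp h1).mul_const (R ^ 2)
    obtain ⟨T, hT⟩ := eventually_atTop.1 (hlim.eventually_lt_const one_pos)
    refine ⟨T, fun t ht => ?_⟩
    rintro _ ⟨x, hx, rfl⟩
    rw [mem_closedBall_zero_iff]
    refine Real.le_sqrt_of_sq_le ((hf.norm_sq_semigroup_le hS t x).trans ?_)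
    have h1 := hT t ht
    have h2 : Real.exp (-(2 * σ) * t) * ‖x‖ ^ 2 ≤ Real.exp (-(2 * σ) * t) * R ^ 2 := by
      have := hR x hx
      gcongr
    linarith

/-- A decaying quadratic functional is bounded on an attractor by its asymptotic bound. -/
theorem norm_sq_le_of_mem_attractor (hf : IsDissipativeField f σ C)
    (hS : IsSolutionSemigroup (IsForwardSolution f) S) {A : Set H} (hA : IsGlobalAttractor S A)
    {H' : Type*} [NormedAddCommGroup H'] [InnerProductSpace ℝ H'] (Q : H →L[ℝ] H') {C' : ℝ}
    (hC' : 0 ≤ C')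
    (h : ∀ u ∈ A, inner ℝ (Q (f u)) (Q u) ≤ -σ * ‖Q u‖ ^ 2 + C') {x : H} (hx : x ∈ A) :
    ‖Q x‖ ^ 2 ≤ C' / σ := by
  obtain ⟨R, hR⟩ := hA.isCompact.isBounded.exists_norm_le
  have hlim : Tendsto (fun t : ℝ≥0 => Real.exp (-(2 * σ) * t) * (‖Q‖ * R) ^ 2 + C' / σ) atTop
      (𝓝 (C' / σ)) := by
    have h1 : Tendsto (fun t : ℝ≥0 => -(2 * σ) * (t : ℝ)) atTop atBot :=
      (NNReal.tendsto_coe_atTop.2 tendsto_id).const_mul_atTop_of_neg (by linarith [hf.rate_pos])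
    simpa using ((Real.tendsto_exp_atBot.comp h1).mul_const ((‖Q‖ * R) ^ 2)).add_const (C' / σ)
  refine ge_of_tendsto' hlim fun t => ?_
  -- Points of the attractor have arbitrarily long histories inside it, so the initial term of the
  -- decay estimate can be sent to zero.
  obtain ⟨y, hy, rfl⟩ : x ∈ S t '' A := by rwa [hA.invariant t]
  have hmem : ∀ s : ℝ, S s.toNNReal y ∈ A := fun s => by
    rw [← hA.invariant s.toNNReal]; exact ⟨y, hy, rfl⟩
  have h1 := (hS y).2.norm_sq_le Q hf.rate_pos hC' (fun s _ => h _ (hmem s)) t.coe_nonneg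
  simp only [Real.toNNReal_coe, Real.toNNReal_zero, (hS y).1] at h1
  refine h1.trans ?_
  have h2 : ‖Q y‖ ≤ ‖Q‖ * R := (Q.le_opNorm y).trans (by have := hR y hy; gcongr)
  gcongr

end IsDissipativeField

end SolutionSemigroup

end

noncomputable section

/-! ### Hilbert structure of `ℓ²_θ`, shifts and multipliers. -/

namespace WeightedL2

variable {θ : LatticeWeight}

@[simp] theorem sub_apply (u v : WeightedL2 θ) (n : ℤ) : (u - v) n = u n - v n := rfl

theorem ext_apply {u v : WeightedL2 θ} (h : ∀ n, u n = v n) : u = v :=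
  Subtype.ext (funext h)

instance : InnerProductSpace ℂ (WeightedL2 θ) where
  inner u v := inner ℂ (toL2 u) (toL2 v)
  norm_sq_eq_re_inner u := by rw [← norm_toL2]; exact norm_sq_eq_re_inner (𝕜 := ℂ) (toL2 u)
  conj_inner_symm u v := inner_conj_symm _ _
  add_left u v w := by rw [toL2_add, inner_add_left]
  smul_left u v r := by rw [toL2_smul, inner_smul_left]

/-- `ℓ²_θ` is isometric to the unweighted `ℓ²`. -/
def toL2Isometry (θ : LatticeWeight) : WeightedL2 θ ≃ₗᵢ[ℂ] lp (fun _ : ℤ => ℂ) 2 :=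
  LinearIsometryEquiv.ofSurjective
    { toFun := toL2, map_add' := toL2_add, map_smul' := toL2_smul, norm_map' := norm_toL2 } <| by
    intro w
    have hs : ∀ n, (Real.sqrt (θ n) : ℂ) ≠ 0 := fun n => by
      exact_mod_cast (Real.sqrt_pos.2 (zero_lt_one.trans_le (θ.one_le n))).ne'
    have hw : (fun n => (Real.sqrt (θ n) : ℂ) * ((Real.sqrt (θ n) : ℂ)⁻¹ * w n)) = w := by
      funext n
      rw [mul_inv_cancel_left₀ (hs n)]
    refine ⟨⟨fun n => (Real.sqrt (θ n) : ℂ)⁻¹ * w n, (θ.memℓp_iff _).1 ?_⟩, ?_⟩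
    · rw [hw]; exact w.2
    · ext n
      exact congrFun hw n

instance : CompleteSpace (WeightedL2 θ) :=
  (toL2Isometry θ).toIsometryEquiv.completeSpace

instance : InnerProductSpace ℝ (WeightedL2 θ) := InnerProductSpace.rclikeToReal ℂ _

theorem hasSum_inner (u v : WeightedL2 θ) :
    HasSum (fun n => θ n * inner ℝ (u n) (v n)) (inner ℝ u v) := by
  have h := Complex.hasSum_re (lp.hasSum_inner (𝕜 := ℂ) (toL2 u) (toL2 v))
  convert! h using 1
  funext n
  have hs : Real.sqrt (θ n) * Real.sqrt (θ n) = θ n := Real.mul_self_sqrt (θ.nonneg n)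
  simp only [Complex.inner, toL2, RCLike.inner_apply, map_mul, Complex.conj_ofReal]
  rw [mul_mul_mul_comm, ← Complex.ofReal_mul, hs, Complex.re_ofReal_mul]

theorem hasSum_norm_sq (u : WeightedL2 θ) : HasSum (fun n => θ n * ‖u n‖ ^ 2) (‖u‖ ^ 2) := by
  simpa using hasSum_inner u u

/-- Uses `θ ≥ 1`. This sup bound is what makes the power nonlinearity act on `ℓ²_θ` and be Lipschitz
on balls. -/
theorem norm_apply_le (u : WeightedL2 θ) (n : ℤ) : ‖u n‖ ≤ ‖u‖ := by
  refine (pow_le_pow_iff_left₀ (norm_nonneg _) (norm_nonneg _) two_ne_zero).1 ?_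
  have h := le_hasSum (hasSum_norm_sq u) n fun m _ => mul_nonneg (θ.nonneg m) (sq_nonneg _)
  nlinarith [θ.one_le n, sq_nonneg ‖u n‖]

theorem mem_of_le {w : ℤ → ℂ} {u : WeightedL2 θ} {c : ℝ} (k : ℤ)
    (h : ∀ n, θ n * ‖w n‖ ^ 2 ≤ c * (θ (n + k) * ‖u (n + k)‖ ^ 2)) : w ∈ weightedSubmodule θ := by
  have hs : Summable fun n => c * (θ (n + k) * ‖u (n + k)‖ ^ 2) :=
    (((Equiv.addRight k).summable_iff (f := fun n => θ n * ‖u n‖ ^ 2)).2 u.2).mul_left c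
  exact Summable.of_nonneg_of_le (fun n => mul_nonneg (θ.nonneg n) (sq_nonneg _)) h hs

theorem norm_sq_le_of_le {w u : WeightedL2 θ} {c : ℝ} (k : ℤ)
    (h : ∀ n, θ n * ‖w n‖ ^ 2 ≤ c * (θ (n + k) * ‖u (n + k)‖ ^ 2)) : ‖w‖ ^ 2 ≤ c * ‖u‖ ^ 2 :=
  hasSum_le h (hasSum_norm_sq w)
    (((Equiv.addRight k).hasSum_iff (f := fun n => θ n * ‖u n‖ ^ 2)).2
      (hasSum_norm_sq u) |>.mul_left c)

theorem norm_le_of_forall_le {w u : WeightedL2 θ} {c : ℝ} (hc : 0 ≤ c)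
    (h : ∀ n, ‖w n‖ ≤ c * ‖u n‖) : ‖w‖ ≤ c * ‖u‖ := by
  refine (pow_le_pow_iff_left₀ (norm_nonneg _) (by positivity) two_ne_zero).1 ?_
  rw [mul_pow]
  refine norm_sq_le_of_le 0 fun n => ?_
  have h1 : ‖w n‖ ^ 2 ≤ (c * ‖u n‖) ^ 2 := by have := h n; gcongr
  have := mul_le_mul_of_nonneg_left h1 (θ.nonneg n)
  rw [add_zero]
  linarith

/-- The shift `u ↦ (u_{n+k})_n`, when `θ_n ≤ c θ_{n+k}`. -/
def shift (k : ℤ) (c : ℝ) (h : ∀ n, θ n ≤ c * θ (n + k)) : WeightedL2 θ →L[ℂ] WeightedL2 θ :=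
  have key : ∀ (u : WeightedL2 θ) (n : ℤ),
      θ n * ‖u (n + k)‖ ^ 2 ≤ c * (θ (n + k) * ‖u (n + k)‖ ^ 2) := fun u n => by
    rw [← mul_assoc]; exact mul_le_mul_of_nonneg_right (h n) (sq_nonneg _)
  LinearMap.mkContinuous
    { toFun := fun u => ⟨fun n => u (n + k), mem_of_le k (key u)⟩
      map_add' := fun _ _ => rfl
      map_smul' := fun _ _ => rfl } (Real.sqrt c) fun u => by
    have hc : 0 ≤ c := by
      have h1 := h 0
      have h2 := θ.one_le 0
      have h3 := θ.one_le (0 + k)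
      by_contra! hneg
      nlinarith
    refine (pow_le_pow_iff_left₀ (norm_nonneg _) (by positivity) two_ne_zero).1 ?_
    rw [mul_pow, Real.sq_sqrt hc]
    exact norm_sq_le_of_le k (key u)

@[simp] theorem shift_apply (k : ℤ) (c : ℝ) (h : ∀ n, θ n ≤ c * θ (n + k)) (u : WeightedL2 θ)
    (n : ℤ) : shift k c h u n = u (n + k) := rfl

/-- Multiplication by a sequence `ρ` with values in `[0, 1]`. -/
def mulBy (ρ : ℤ → ℝ) (h0 : ∀ n, 0 ≤ ρ n) (h1 : ∀ n, ρ n ≤ 1) :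
    WeightedL2 θ →L[ℂ] WeightedL2 θ :=
  have key : ∀ (u : WeightedL2 θ) (n : ℤ), ‖(ρ n : ℂ) * u n‖ ≤ 1 * ‖u n‖ := fun u n => by
    rw [norm_mul, Complex.norm_real, Real.norm_of_nonneg (h0 n)]
    exact mul_le_mul_of_nonneg_right (h1 n) (norm_nonneg _)
  LinearMap.mkContinuous
    { toFun := fun u => ⟨fun n => ρ n * u n, mem_of_le (c := 1) (u := u) 0 fun n => by
        have := key u n
        rw [one_mul] at this ⊢
        rw [add_zero]
        exact mul_le_mul_of_nonneg_left (by gcongr) (θ.nonneg n)⟩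
      map_add' := fun _ _ => ext_apply fun _ => mul_add _ _ _
      map_smul' := fun _ _ => ext_apply fun _ => mul_left_comm _ _ _ } 1 fun u =>
    norm_le_of_forall_le zero_le_one (key u)

@[simp] theorem mulBy_apply (ρ : ℤ → ℝ) (h0 : ∀ n, 0 ≤ ρ n) (h1 : ∀ n, ρ n ≤ 1)
    (u : WeightedL2 θ) (n : ℤ) : mulBy ρ h0 h1 u n = ρ n * u n := rfl

theorem norm_mulBy_le (ρ : ℤ → ℝ) (h0 : ∀ n, 0 ≤ ρ n) (h1 : ∀ n, ρ n ≤ 1) (u : WeightedL2 θ) :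
    ‖mulBy ρ h0 h1 u‖ ≤ ‖u‖ := by
  refine (norm_le_of_forall_le zero_le_one fun n => ?_).trans_eq (one_mul _)
  rw [mulBy_apply, norm_mul, Complex.norm_real, Real.norm_of_nonneg (h0 n)]
  exact mul_le_mul_of_nonneg_right (h1 n) (norm_nonneg _)

end WeightedL2

/-! ### Lipschitz bounds for the nonlinearity. -/

theorem norm_gaugeF {p : ℝ} (z : ℂ) : ‖gaugeF p z‖ = ‖z‖ ^ (p - 1) * ‖z‖ := by
  rw [gaugeF, norm_mul, Complex.norm_real, Real.norm_of_nonneg (by positivity)]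

/-- For `p` near `1` the factor `|z|^(p-1)` is not Lipschitz at `0`, so its increment is estimated
only after multiplication by the smaller modulus `‖w‖`. -/
theorem norm_gaugeF_sub_le {p : ℝ} (hp : 1 < p) {R : ℝ} {z w : ℂ} (hz : ‖z‖ ≤ R) (hw : ‖w‖ ≤ R) :
    ‖gaugeF p z - gaugeF p w‖ ≤ (1 + p) * R ^ (p - 1) * ‖z - w‖ := by
  wlog h : ‖w‖ ≤ ‖z‖ generalizing z w
  · rw [norm_sub_rev, norm_sub_rev z]
    exact this hw hz (le_of_not_ge h)
  rcases eq_or_lt_of_le (norm_nonneg z) with hz0 | hz0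
  · have hz' : z = 0 := norm_eq_zero.1 hz0.symm
    have hw' : w = 0 := norm_le_zero_iff.1 (h.trans hz0.symm.le)
    simp [hz', hw']
  have hpos : 0 ≤ p - 1 := by linarith
  have key : gaugeF p z - gaugeF p w = ((‖z‖ ^ (p - 1) : ℝ) : ℂ) * (z - w)
      + ((‖z‖ ^ (p - 1) - ‖w‖ ^ (p - 1) : ℝ) : ℂ) * w := by
    simp only [gaugeF]; push_cast; ring
  have hmono : ‖w‖ ^ (p - 1) ≤ ‖z‖ ^ (p - 1) := Real.rpow_le_rpow (norm_nonneg _) h hpos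
  have hbern : (‖z‖ ^ (p - 1) - ‖w‖ ^ (p - 1)) * ‖w‖ ≤ p * ‖z‖ ^ (p - 1) * (‖z‖ - ‖w‖) := by
    -- Bernoulli at `‖w‖/‖z‖`, i.e. convexity of `x ↦ x^p`: `‖z‖^p - ‖w‖^p ≤ p‖z‖^(p-1)(‖z‖ - ‖w‖)`.
    have h1 := one_add_mul_self_le_rpow_one_add (s := ‖w‖ / ‖z‖ - 1) (p := p)
      (by have : 0 ≤ ‖w‖ / ‖z‖ := by positivity
          linarith) hp.le
    rw [add_sub_cancel, Real.div_rpow (norm_nonneg _) (norm_nonneg _)] at h1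
    have e1 : ∀ x : ℝ, 0 ≤ x → x ^ p = x ^ (p - 1) * x := fun x hx => by
      rw [← Real.rpow_add_one' hx (by linarith), sub_add_cancel]
    rw [e1 _ (norm_nonneg z), e1 _ (norm_nonneg w)] at h1
    have hzp : 0 < ‖z‖ ^ (p - 1) := Real.rpow_pos_of_pos hz0 _
    rw [le_div_iff₀ (by positivity)] at h1
    have h2 : (1 + p * (‖w‖ / ‖z‖ - 1)) * (‖z‖ ^ (p - 1) * ‖z‖)
        = ‖z‖ ^ (p - 1) * (‖z‖ - p * (‖z‖ - ‖w‖)) := by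
      field_simp
      ring
    rw [h2] at h1
    have h3 : ‖z‖ ^ (p - 1) * ‖w‖ ≤ ‖z‖ ^ (p - 1) * ‖z‖ := by gcongr
    linarith
  have hR0 : 0 ≤ R := (norm_nonneg z).trans hz
  have hp0 : 0 ≤ p := by linarith
  have hsub : ‖z‖ - ‖w‖ ≤ ‖z - w‖ := norm_sub_norm_le z w
  have hR : ‖z‖ ^ (p - 1) ≤ R ^ (p - 1) := Real.rpow_le_rpow (norm_nonneg _) hz hpos
  rw [key]
  refine (norm_add_le _ _).trans ?_
  rw [norm_mul, norm_mul, Complex.norm_real, Complex.norm_real, Real.norm_of_nonneg (by positivity),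
    Real.norm_of_nonneg (sub_nonneg.2 hmono)]
  calc _ ≤ ‖z‖ ^ (p - 1) * ‖z - w‖ + p * ‖z‖ ^ (p - 1) * (‖z‖ - ‖w‖) := by gcongr
    _ ≤ R ^ (p - 1) * ‖z - w‖ + p * R ^ (p - 1) * ‖z - w‖ := by gcongr
    _ = _ := by ring

namespace WeightedL2

variable {θ : LatticeWeight}

/-- The nonlinearity `F` acting on `ℓ²_θ`. -/
def gaugeMap (p : ℝ) (hp : 1 < p) (u : WeightedL2 θ) : WeightedL2 θ :=
  ⟨fun n => gaugeF p (u n), mem_of_le (c := (‖u‖ ^ (p - 1)) ^ 2) (u := u) 0 fun n => by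
    have h1 : ‖u n‖ ^ (p - 1) ≤ ‖u‖ ^ (p - 1) :=
      Real.rpow_le_rpow (norm_nonneg _) (norm_apply_le u n) (by linarith)
    have h2 : (‖u n‖ ^ (p - 1)) ^ 2 ≤ (‖u‖ ^ (p - 1)) ^ 2 := by gcongr
    have h3 : 0 ≤ θ n * ‖u n‖ ^ 2 := mul_nonneg (θ.nonneg n) (sq_nonneg _)
    rw [norm_gaugeF, add_zero, mul_pow, mul_left_comm]
    exact mul_le_mul_of_nonneg_right h2 h3⟩

@[simp] theorem gaugeMap_apply (p : ℝ) (hp : 1 < p) (u : WeightedL2 θ) (n : ℤ) :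
    gaugeMap p hp u n = gaugeF p (u n) := rfl

theorem norm_gaugeMap_sub_le {p : ℝ} (hp : 1 < p) {R : ℝ} {u v : WeightedL2 θ} (hu : ‖u‖ ≤ R)
    (hv : ‖v‖ ≤ R) :
    ‖gaugeMap p hp u - gaugeMap p hp v‖ ≤ (1 + p) * R ^ (p - 1) * ‖u - v‖ := by
  have hR : 0 ≤ R := (norm_nonneg u).trans hu
  have hp0 : 0 ≤ p := by linarith
  exact norm_le_of_forall_le (by positivity) fun n =>
    norm_gaugeF_sub_le hp ((norm_apply_le u n).trans hu) ((norm_apply_le v n).trans hv)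

end WeightedL2

end

noncomputable section

/-! ### The energy inequality and its localized form. -/

namespace LatticeWeight.WS

variable {θ : LatticeWeight} {D dlow dup : ℝ}

theorem le_succ (h : θ.WS D dlow dup) (n : ℤ) : θ n ≤ dlow⁻¹ * θ (n + 1) := by
  rw [inv_mul_eq_div, le_div_iff₀ h.dlow_pos, mul_comm]
  exact h.lower n

theorem le_pred (h : θ.WS D dlow dup) (n : ℤ) : θ n ≤ dup * θ (n + -1) := by
  simpa using h.upper (n + -1)

/-- The weight absorbs neighbouring products: `θ_n x y ≤ (d^{-1/2}/2)(θ_n x² + θ_{n+1} y²)`. -/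
theorem mul_mul_le (h : θ.WS D dlow dup) (n : ℤ) {x y : ℝ} :
    θ n * (x * y) ≤ dlow ^ (-(1 / 2) : ℝ) / 2 * (θ n * x ^ 2 + θ (n + 1) * y ^ 2) := by
  set r := dlow ^ (-(1 / 2) : ℝ) with hr
  have hr0 : 0 < r := Real.rpow_pos_of_pos h.dlow_pos _
  have hrr : r * r * dlow = 1 := by
    rw [hr, ← Real.rpow_add h.dlow_pos, ← Real.rpow_add_one h.dlow_pos.ne']
    norm_num
  have h1 : r / 2 * (dlow * θ n * y ^ 2) ≤ r / 2 * (θ (n + 1) * y ^ 2) := by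
    have := h.lower n
    gcongr
  -- Young's inequality balanced by `r² dlow = 1`, which gives both squares the same coefficient `r
  -- / 2`.
  have h2 : 0 ≤ θ n * dlow * (r / 2) * (r * x - y) ^ 2 :=
    mul_nonneg (mul_nonneg (mul_nonneg (θ.nonneg n) h.dlow_pos.le) (by positivity)) (sq_nonneg _)
  have h3 : θ n * dlow * (r / 2) * (r * x - y) ^ 2 = (r * r * dlow) * (r / 2 * (θ n * x ^ 2))
      - (r * r * dlow) * (θ n * (x * y)) + r / 2 * (dlow * θ n * y ^ 2) := by ring
  rw [h3, hrr] at h2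
  linarith

end LatticeWeight.WS

/-- The right side of the lattice equation solved for `u̇_n`, at a site with values `a` there and
`b`, `c` at its neighbours. -/
def siteField (P : LatticeParams) (a b c d : ℂ) : ℂ :=
  Complex.I * (((P.α : ℂ) + Complex.I * (P.β : ℂ)) * (b - 2 * a + c)
    + ((P.γ : ℂ) + Complex.I * (P.δ : ℂ)) * a
    + ((P.η : ℂ) + Complex.I * (P.ζ : ℂ)) * gaugeF P.p a - d)

theorem latticeLHS_eq_iff (P : LatticeParams) (du u : ℤ → ℂ) (n : ℤ) (d : ℂ) :
    latticeLHS P du u n = d ↔ du n = siteField P (u n) (u (n - 1)) (u (n + 1)) d := by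
  have hI : Complex.I * Complex.I = -1 := Complex.I_mul_I
  unfold latticeLHS siteField
  constructor
  · rintro rfl
    linear_combination (du n) * hI
  · intro h
    rw [h]
    linear_combination (((P.α : ℂ) + Complex.I * (P.β : ℂ)) * (u (n - 1) - 2 * u n + u (n + 1))
      + ((P.γ : ℂ) + Complex.I * (P.δ : ℂ)) * u n
      + ((P.η : ℂ) + Complex.I * (P.ζ : ℂ)) * gaugeF P.p (u n) - d) * hI

/-- The pointwise energy inequality. -/
theorem inner_siteField_le (P : LatticeParams) (hζ : 0 < P.ζ) {ε : ℝ} (hε : 0 < ε)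
    (a b c d : ℂ) :
    inner ℝ (siteField P a b c d) a ≤ (2 * P.β - P.δ + ε / 2) * ‖a‖ ^ 2
      + |P.β| * (‖a‖ ^ 2 + ‖b‖ ^ 2 / 2 + ‖c‖ ^ 2 / 2)
      - P.α * (inner ℝ (Complex.I * a) b + inner ℝ (Complex.I * a) c)
      + ‖d‖ ^ 2 / (2 * ε) := by
  -- `γ` and `η` disappear because `i a` is orthogonal to `a`. The `α` terms are kept exact: they
  -- cancel only after summation over sites.
  have e : inner ℝ (siteField P a b c d) a = (2 * P.β - P.δ) * ‖a‖ ^ 2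
      - P.β * (inner ℝ b a + inner ℝ c a)
      - P.α * (inner ℝ (Complex.I * a) b + inner ℝ (Complex.I * a) c)
      - P.ζ * (‖a‖ ^ (P.p - 1) * ‖a‖ ^ 2) - inner ℝ (Complex.I * d) a := by
    simp only [siteField, gaugeF, Complex.inner, Complex.sq_norm, Complex.normSq_apply,
      Complex.mul_re, Complex.mul_im, Complex.add_re, Complex.add_im, Complex.sub_re,
      Complex.sub_im, Complex.I_re, Complex.I_im, Complex.ofReal_re, Complex.ofReal_im,
      Complex.conj_re, Complex.conj_im, Complex.re_ofNat, Complex.im_ofNat]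
    ring
  have h1 : -(P.β * (inner ℝ b a + inner ℝ c a))
      ≤ |P.β| * (‖a‖ ^ 2 + ‖b‖ ^ 2 / 2 + ‖c‖ ^ 2 / 2) := by
    refine (neg_le_abs _).trans ?_
    rw [abs_mul]
    refine mul_le_mul_of_nonneg_left ?_ (abs_nonneg _)
    refine (abs_add_le _ _).trans ?_
    have hb := abs_real_inner_le_norm b a
    have hc := abs_real_inner_le_norm c a
    nlinarith [sq_nonneg (‖b‖ - ‖a‖), sq_nonneg (‖c‖ - ‖a‖)]
  have h2 : 0 ≤ P.ζ * (‖a‖ ^ (P.p - 1) * ‖a‖ ^ 2) := by positivity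
  have h3 : -inner ℝ (Complex.I * d) a ≤ ε / 2 * ‖a‖ ^ 2 + ‖d‖ ^ 2 / (2 * ε) := by
    refine (neg_le_abs _).trans ((abs_real_inner_le_norm _ _).trans ?_)
    rw [norm_mul, Complex.norm_I, one_mul]
    have h4 : ε / 2 * ‖a‖ ^ 2 + ‖d‖ ^ 2 / (2 * ε) - ‖d‖ * ‖a‖
        = (ε * ‖a‖ - ‖d‖) ^ 2 / (2 * ε) := by field_simp; ring
    have h5 : 0 ≤ (ε * ‖a‖ - ‖d‖) ^ 2 / (2 * ε) := by positivity
    linarith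
  rw [e]
  linarith

/-- The dissipation rate in the smallness condition on the parameters. -/
def dissipationRate (P : LatticeParams) (D dlow dup ε : ℝ) : ℝ :=
  P.δ - ε / 2 - 2 * P.β - |P.α| * D * dlow ^ (-(1 / 2) : ℝ)
    - |P.β| * (1 + dup / 2 + dlow⁻¹ / 2)

/-- The constant in front of the cut-off error in the energy inequality. -/
def cutoffConst (P : LatticeParams) (D dlow dup : ℝ) : ℝ :=
  |P.α| * (D * dlow ^ (-(1 / 2) : ℝ) + dup + 1) + |P.β| * (dup + dlow⁻¹)

namespace WeightedL2

variable {θ : LatticeWeight} {D dlow dup : ℝ}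

/-- The vector field of the lattice equation on `ℓ²_θ`. -/
def latticeField (hWS : θ.WS D dlow dup) (P : LatticeParams) (hp : 1 < P.p) (g : WeightedL2 θ)
    (u : WeightedL2 θ) : WeightedL2 θ :=
  Complex.I • (((P.α : ℂ) + Complex.I * (P.β : ℂ)) •
      (shift (-1) dup hWS.le_pred u - (2 : ℂ) • u + shift 1 dlow⁻¹ hWS.le_succ u)
    + ((P.γ : ℂ) + Complex.I * (P.δ : ℂ)) • u
    + ((P.η : ℂ) + Complex.I * (P.ζ : ℂ)) • gaugeMap P.p hp u - g)

theorem latticeField_apply (hWS : θ.WS D dlow dup) (P : LatticeParams) (hp : 1 < P.p)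
    (g u : WeightedL2 θ) (n : ℤ) :
    latticeField hWS P hp g u n = siteField P (u n) (u (n - 1)) (u (n + 1)) (g n) := rfl

theorem exists_lipschitzOnWith_latticeField (hWS : θ.WS D dlow dup) (P : LatticeParams)
    (hp : 1 < P.p) (g : WeightedL2 θ) (R : ℝ) :
    ∃ K : ℝ≥0, LipschitzOnWith K (latticeField hWS P hp g) (Metric.closedBall 0 R) := by
  let L : WeightedL2 θ →L[ℂ] WeightedL2 θ :=
    Complex.I • (((P.α : ℂ) + Complex.I * (P.β : ℂ)) •
      (shift (-1) dup hWS.le_pred - (2 : ℂ) • ContinuousLinearMap.id ℂ _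
        + shift 1 dlow⁻¹ hWS.le_succ)
    + ((P.γ : ℂ) + Complex.I * (P.δ : ℂ)) • ContinuousLinearMap.id ℂ _)
  let c : ℂ := Complex.I * ((P.η : ℂ) + Complex.I * (P.ζ : ℂ))
  have hdecomp : ∀ u v, latticeField hWS P hp g u - latticeField hWS P hp g v
      = L (u - v) + c • (gaugeMap P.p hp u - gaugeMap P.p hp v) := by
    intro u v
    refine ext_apply fun n => ?_
    simp [latticeField, L, c]
    ring
  refine ⟨(‖L‖ + ‖c‖ * ((1 + P.p) * R ^ (P.p - 1))).toNNReal,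
    LipschitzOnWith.of_dist_le_mul fun u hu v hv => ?_⟩
  rw [mem_closedBall_zero_iff] at hu hv
  have hR : 0 ≤ R := (norm_nonneg u).trans hu
  have hp0 : 0 ≤ P.p := by linarith
  rw [dist_eq_norm, dist_eq_norm, hdecomp, Real.coe_toNNReal _ (by positivity), add_mul, mul_assoc]
  refine (norm_add_le _ _).trans (add_le_add (L.le_opNorm _) ?_)
  rw [norm_smul]
  exact mul_le_mul_of_nonneg_left (norm_gaugeMap_sub_le hp hu hv) (norm_nonneg _)

/-- The energy inequality, localized by a cut-off `ρ` with values in `[0, 1]` whose increments are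
at most `κ`. -/
theorem inner_mulBy_latticeField_le (hWS : θ.WS D dlow dup) (P : LatticeParams) (hp : 1 < P.p)
    (hζ : 0 < P.ζ) {ε : ℝ} (hε : 0 < ε) (g u : WeightedL2 θ) (ρ : ℤ → ℝ) (h0 : ∀ n, 0 ≤ ρ n)
    (h1 : ∀ n, ρ n ≤ 1) {κ : ℝ} (hκ : ∀ n, |ρ (n + 1) - ρ n| ≤ κ) :
    inner ℝ (mulBy ρ h0 h1 (latticeField hWS P hp g u)) (mulBy ρ h0 h1 u)
      ≤ -dissipationRate P D dlow dup ε * ‖mulBy ρ h0 h1 u‖ ^ 2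
        + (cutoffConst P D dlow dup * κ * ‖u‖ ^ 2 + ‖mulBy ρ h0 h1 g‖ ^ 2 / (2 * ε)) := by
  set Q := mulBy (θ := θ) ρ h0 h1 with hQ
  set r := dlow ^ (-(1 / 2) : ℝ) with hr
  have hr0 : 0 < r := Real.rpow_pos_of_pos hWS.dlow_pos _
  have hκ0 : 0 ≤ κ := (abs_nonneg _).trans (hκ 0)
  have hsq : ∀ w : WeightedL2 θ, HasSum (fun n => ρ n ^ 2 * (θ n * ‖w n‖ ^ 2)) (‖Q w‖ ^ 2) := by
    intro w
    convert! hasSum_norm_sq (Q w) using 1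
    funext n
    rw [hQ, mulBy_apply, norm_mul, Complex.norm_real, mul_pow, Real.norm_eq_abs, sq_abs]
    ring
  have hin : ∀ v w : WeightedL2 θ,
      HasSum (fun n => ρ n ^ 2 * (θ n * inner ℝ (v n) (w n))) (inner ℝ (Q v) (Q w)) := by
    intro v w
    convert! hasSum_inner (Q v) (Q w) using 1
    funext n
    simp only [hQ, mulBy_apply, Complex.inner, map_mul, Complex.conj_ofReal]
    rw [mul_mul_mul_comm, ← Complex.ofReal_mul, Complex.re_ofReal_mul]
    ring
  have shiftSum : ∀ {F : ℤ → ℝ} {s : ℝ} (k : ℤ), HasSum F s → HasSum (fun n => F (n + k)) s :=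
    fun k h => (Equiv.addRight k).hasSum_iff.2 h
  have hY := hsq u
  have hT := hasSum_norm_sq u
  have hG := hsq g
  have hL := hin (latticeField hWS P hp g u) u
  -- The flux through the bond from `n - 1` to `n`; its telescoping difference sums to zero.
  set B : ℤ → ℝ := fun n => ρ n ^ 2 * (θ n * inner ℝ (Complex.I * u n) (u (n - 1))) with hB
  have hBs : HasSum B (inner ℝ (Q (Complex.I • u)) (Q (shift (-1) dup hWS.le_pred u))) :=
    hin (Complex.I • u) (shift (-1) dup hWS.le_pred u)
  have hlocal : ∀ n, ρ n ^ 2 * (θ n * inner ℝ (latticeField hWS P hp g u n) (u n))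
      ≤ (2 * P.β - P.δ + ε / 2 + |P.β|) * (ρ n ^ 2 * (θ n * ‖u n‖ ^ 2))
        + |P.β| * dup / 2 * (ρ (n + -1) ^ 2 * (θ (n + -1) * ‖u (n + -1)‖ ^ 2)
            + 2 * κ * (θ (n + -1) * ‖u (n + -1)‖ ^ 2))
        + |P.β| * dlow⁻¹ / 2 * (ρ (n + 1) ^ 2 * (θ (n + 1) * ‖u (n + 1)‖ ^ 2)
            + 2 * κ * (θ (n + 1) * ‖u (n + 1)‖ ^ 2))
        + (P.α * B (n + 1) - P.α * B n)
        + |P.α| * (D * r / 2 * (ρ n ^ 2 * (θ n * ‖u n‖ ^ 2)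
              + ρ (n + 1) ^ 2 * (θ (n + 1) * ‖u (n + 1)‖ ^ 2)
              + 2 * κ * (θ (n + 1) * ‖u (n + 1)‖ ^ 2))
            + κ * (dup * (θ n * ‖u n‖ ^ 2) + θ (n + 1) * ‖u (n + 1)‖ ^ 2))
        + (2 * ε)⁻¹ * (ρ n ^ 2 * (θ n * ‖g n‖ ^ 2)) := by
    intro n
    have hsqdiff : ∀ m, |ρ (m + 1) ^ 2 - ρ m ^ 2| ≤ 2 * κ := by
      intro m
      rw [sq_sub_sq, abs_mul]
      have e1 : |ρ (m + 1) + ρ m| ≤ 2 := by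
        rw [abs_of_nonneg (add_nonneg (h0 _) (h0 _))]
        linarith [h1 (m + 1), h1 m]
      exact mul_le_mul e1 (hκ m) (abs_nonneg _) (by norm_num)
    have hm : n + -1 = n - 1 := rfl
    have hw : 0 ≤ ρ n ^ 2 := sq_nonneg _
    have hθ := θ.nonneg n
    have hθ1 := θ.nonneg (n + 1)
    have hsite := mul_le_mul_of_nonneg_left
      (inner_siteField_le P hζ hε (u n) (u (n - 1)) (u (n + 1)) (g n)) (mul_nonneg hw hθ)
    rw [latticeField_apply]
    have hbL : ρ n ^ 2 * θ n * ‖u (n - 1)‖ ^ 2 ≤ dup * (ρ (n - 1) ^ 2 *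
        (θ (n - 1) * ‖u (n - 1)‖ ^ 2) + 2 * κ * (θ (n - 1) * ‖u (n - 1)‖ ^ 2)) := by
      have e1 : ρ n ^ 2 ≤ ρ (n - 1) ^ 2 + 2 * κ := by
        have := (abs_le.1 (hsqdiff (n - 1))).2
        rw [sub_add_cancel] at this
        linarith
      have e2 : θ n ≤ dup * θ (n - 1) := hWS.le_pred n
      calc _ ≤ (ρ (n - 1) ^ 2 + 2 * κ) * (dup * θ (n - 1)) * ‖u (n - 1)‖ ^ 2 := by gcongr
        _ = _ := by ring
    have hbR : ρ n ^ 2 * θ n * ‖u (n + 1)‖ ^ 2 ≤ dlow⁻¹ * (ρ (n + 1) ^ 2 *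
        (θ (n + 1) * ‖u (n + 1)‖ ^ 2) + 2 * κ * (θ (n + 1) * ‖u (n + 1)‖ ^ 2)) := by
      have e1 : ρ n ^ 2 ≤ ρ (n + 1) ^ 2 + 2 * κ := by
        have := (abs_le.1 (hsqdiff n)).1
        linarith
      have e2 : θ n ≤ dlow⁻¹ * θ (n + 1) := hWS.le_succ n
      calc _ ≤ (ρ (n + 1) ^ 2 + 2 * κ) * (dlow⁻¹ * θ (n + 1)) * ‖u (n + 1)‖ ^ 2 := by gcongr
        _ = _ := by ring
    -- Antisymmetry of `⟪i·, ·⟫` lets the two `α` terms at a site pair up across a bond, leaving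
    -- only the increment of `ρ²θ`.
    have hB1 : B (n + 1)
        = -(ρ (n + 1) ^ 2 * (θ (n + 1) * inner ℝ (Complex.I * u n) (u (n + 1)))) := by
      simp only [hB, Complex.inner, Complex.mul_re, Complex.mul_im, Complex.I_re, Complex.I_im,
        Complex.conj_re, Complex.conj_im, add_sub_cancel_right]
      ring
    have hαterm : -P.α * ((ρ n ^ 2 * θ n - ρ (n + 1) ^ 2 * θ (n + 1))
          * inner ℝ (Complex.I * u n) (u (n + 1)))
        ≤ |P.α| * (D * r / 2 * (ρ n ^ 2 * (θ n * ‖u n‖ ^ 2)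
              + ρ (n + 1) ^ 2 * (θ (n + 1) * ‖u (n + 1)‖ ^ 2)
              + 2 * κ * (θ (n + 1) * ‖u (n + 1)‖ ^ 2))
            + κ * (dup * (θ n * ‖u n‖ ^ 2) + θ (n + 1) * ‖u (n + 1)‖ ^ 2)) := by
      refine (le_abs_self _).trans ?_
      rw [abs_mul, abs_neg, abs_mul]
      refine mul_le_mul_of_nonneg_left ?_ (abs_nonneg _)
      have e1 : |inner ℝ (Complex.I * u n) (u (n + 1))| ≤ ‖u n‖ * ‖u (n + 1)‖ := by
        simpa using abs_real_inner_le_norm (Complex.I * u n) (u (n + 1))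
      -- Discrete product rule: the increment of `θ` costs `D`, which enters the rate, and that of
      -- `ρ²` costs `2κ`, which enters the cut-off error.
      have e2 : |ρ n ^ 2 * θ n - ρ (n + 1) ^ 2 * θ (n + 1)|
          ≤ ρ n ^ 2 * (D * θ n) + 2 * κ * θ (n + 1) := by
        have : ρ n ^ 2 * θ n - ρ (n + 1) ^ 2 * θ (n + 1)
            = -(ρ n ^ 2 * (θ (n + 1) - θ n)) - (ρ (n + 1) ^ 2 - ρ n ^ 2) * θ (n + 1) := by ring
        rw [this]
        refine (abs_sub _ _).trans ?_
        rw [abs_neg, abs_mul, abs_mul, abs_of_nonneg hw, abs_of_nonneg hθ1]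
        exact add_le_add (mul_le_mul_of_nonneg_left (hWS.increment n) hw)
          (mul_le_mul_of_nonneg_right (hsqdiff n) hθ1)
      have e3 : ρ n ^ 2 * (D * θ n) * (‖u n‖ * ‖u (n + 1)‖)
          ≤ D * r / 2 * (ρ n ^ 2 * (θ n * ‖u n‖ ^ 2)
              + ρ (n + 1) ^ 2 * (θ (n + 1) * ‖u (n + 1)‖ ^ 2)
              + 2 * κ * (θ (n + 1) * ‖u (n + 1)‖ ^ 2)) := by
        have f1 := hWS.mul_mul_le n (x := ‖u n‖) (y := ‖u (n + 1)‖)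
        have f2 : ρ n ^ 2 * (θ (n + 1) * ‖u (n + 1)‖ ^ 2)
            ≤ (ρ (n + 1) ^ 2 + 2 * κ) * (θ (n + 1) * ‖u (n + 1)‖ ^ 2) := by
          have := (abs_le.1 (hsqdiff n)).1
          have : ρ n ^ 2 ≤ ρ (n + 1) ^ 2 + 2 * κ := by linarith
          gcongr
        have hD := hWS.D_pos
        calc ρ n ^ 2 * (D * θ n) * (‖u n‖ * ‖u (n + 1)‖)
            = ρ n ^ 2 * D * (θ n * (‖u n‖ * ‖u (n + 1)‖)) := by ring
          _ ≤ ρ n ^ 2 * D * (r / 2 * (θ n * ‖u n‖ ^ 2 + θ (n + 1) * ‖u (n + 1)‖ ^ 2)) := by gcongr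
          _ = D * r / 2 * (ρ n ^ 2 * (θ n * ‖u n‖ ^ 2)
                + ρ n ^ 2 * (θ (n + 1) * ‖u (n + 1)‖ ^ 2)) := by ring
          _ ≤ D * r / 2 * (ρ n ^ 2 * (θ n * ‖u n‖ ^ 2)
                + (ρ (n + 1) ^ 2 + 2 * κ) * (θ (n + 1) * ‖u (n + 1)‖ ^ 2)) := by gcongr
          _ = _ := by ring
      have e4 : 2 * κ * θ (n + 1) * (‖u n‖ * ‖u (n + 1)‖)
          ≤ κ * (dup * (θ n * ‖u n‖ ^ 2) + θ (n + 1) * ‖u (n + 1)‖ ^ 2) := by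
        have f1 : θ (n + 1) * ‖u n‖ ^ 2 ≤ dup * θ n * ‖u n‖ ^ 2 := by
          have := hWS.upper n
          gcongr
        have f2 : θ (n + 1) * (2 * (‖u n‖ * ‖u (n + 1)‖))
            ≤ θ (n + 1) * (‖u n‖ ^ 2 + ‖u (n + 1)‖ ^ 2) := by
          refine mul_le_mul_of_nonneg_left ?_ hθ1
          linarith [two_mul_le_add_sq ‖u n‖ ‖u (n + 1)‖]
        have f3 := mul_le_mul_of_nonneg_left (f2.trans (by linarith :
          _ ≤ dup * (θ n * ‖u n‖ ^ 2) + θ (n + 1) * ‖u (n + 1)‖ ^ 2)) hκ0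
        linarith
      calc _ ≤ (ρ n ^ 2 * (D * θ n) + 2 * κ * θ (n + 1)) * (‖u n‖ * ‖u (n + 1)‖) :=
            mul_le_mul e2 e1 (abs_nonneg _) ((abs_nonneg _).trans e2)
        _ ≤ _ := by linarith
    have hβ := abs_nonneg P.β
    have gL := mul_le_mul_of_nonneg_left hbL (by positivity : 0 ≤ |P.β| / 2)
    have gR := mul_le_mul_of_nonneg_left hbR (by positivity : 0 ≤ |P.β| / 2)
    have hBn : B n = ρ n ^ 2 * (θ n * inner ℝ (Complex.I * u n) (u (n - 1))) := rfl
    have hdiv : ‖g n‖ ^ 2 / (2 * ε) = (2 * ε)⁻¹ * ‖g n‖ ^ 2 := by rw [div_eq_inv_mul]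
    rw [hB1, hBn, hm]
    rw [hdiv] at hsite
    linarith
  have hR := ((((hY.mul_left (2 * P.β - P.δ + ε / 2 + |P.β|)).add
    (((shiftSum (-1) hY).add ((shiftSum (-1) hT).mul_left (2 * κ))).mul_left (|P.β| * dup / 2))).add
    (((shiftSum 1 hY).add ((shiftSum 1 hT).mul_left (2 * κ))).mul_left (|P.β| * dlow⁻¹ / 2))).add
    (((shiftSum 1 hBs).mul_left P.α).sub (hBs.mul_left P.α))).add
    (((((hY.add (shiftSum 1 hY)).add ((shiftSum 1 hT).mul_left (2 * κ))).mul_left (D * r / 2)).add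
      (((hT.mul_left dup).add (shiftSum 1 hT)).mul_left κ)).mul_left |P.α|) |>.add
    (hG.mul_left (2 * ε)⁻¹)
  refine (hasSum_le hlocal hL hR).trans_eq ?_
  rw [dissipationRate, cutoffConst, ← hr, div_eq_inv_mul (‖Q g‖ ^ 2)]
  ring

end WeightedL2

end

noncomputable section

/-! ### Tail cut-offs and truncation to finitely many sites. -/

namespace WeightedL2

variable {θ : LatticeWeight} {D dlow dup : ℝ}

/-- The cut-off `n ↦ min(1, |n|/(K+1))`, which equals `1` for `|n| > K`. -/
def tailCutoff (K : ℕ) (n : ℤ) : ℝ := min 1 (|(n : ℝ)| / (K + 1))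

theorem tailCutoff_nonneg (K : ℕ) (n : ℤ) : 0 ≤ tailCutoff K n :=
  le_min zero_le_one (by positivity)

theorem tailCutoff_le_one (K : ℕ) (n : ℤ) : tailCutoff K n ≤ 1 := min_le_left _ _

theorem tailCutoff_of_lt {K : ℕ} {n : ℤ} (h : (K : ℤ) < |n|) : tailCutoff K n = 1 := by
  refine min_eq_left ((one_le_div (by positivity)).2 ?_)
  have h' : (K : ℤ) + 1 ≤ |n| := h
  exact_mod_cast h'

theorem abs_tailCutoff_succ_sub_le (K : ℕ) (n : ℤ) :
    |tailCutoff K (n + 1) - tailCutoff K n| ≤ 1 / ((K : ℝ) + 1) := by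
  have hK : (0 : ℝ) < (K : ℝ) + 1 := by positivity
  refine (abs_min_sub_min_le_max _ _ _ _).trans (max_le (by simp; positivity) ?_)
  rw [← sub_div, abs_div, abs_of_pos hK]
  gcongr
  refine (abs_abs_sub_abs_le _ _).trans ?_
  push_cast
  simp

/-- Multiplication by the cut-off; `‖tail K u‖` controls the part of `u` beyond `K`. -/
def tail (K : ℕ) : WeightedL2 θ →L[ℂ] WeightedL2 θ :=
  mulBy (tailCutoff K) (tailCutoff_nonneg K) (tailCutoff_le_one K)

theorem tail_apply_of_lt {K : ℕ} {n : ℤ} (h : (K : ℤ) < |n|) (u : WeightedL2 θ) :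
    tail K u n = u n := by
  rw [tail, mulBy_apply, tailCutoff_of_lt h, Complex.ofReal_one, one_mul]

theorem tendsto_norm_tail (u : WeightedL2 θ) :
    Tendsto (fun K => ‖tail K u‖) atTop (𝓝 0) := by
  have hterm : ∀ (K : ℕ) (n : ℤ),
      θ n * ‖tail K u n‖ ^ 2 = tailCutoff K n ^ 2 * (θ n * ‖u n‖ ^ 2) := fun K n => by
    rw [tail, mulBy_apply, norm_mul, Complex.norm_real, mul_pow, Real.norm_eq_abs, sq_abs]
    ring
  have hsum : Tendsto (fun K : ℕ => ∑' n, θ n * ‖tail K u n‖ ^ 2) atTop (𝓝 (∑' _ : ℤ, (0 : ℝ))) := by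
    refine tendsto_tsum_of_dominated_convergence (bound := fun n => θ n * ‖u n‖ ^ 2) u.2 ?_ ?_
    · intro n
      have h1 : Tendsto (fun K : ℕ => |(n : ℝ)| / ((K : ℝ) + 1)) atTop (𝓝 0) :=
        tendsto_const_nhds.div_atTop
          (tendsto_atTop_add_const_right _ _ tendsto_natCast_atTop_atTop)
      have h2 : Tendsto (fun K : ℕ => tailCutoff K n) atTop (𝓝 0) :=
        squeeze_zero (fun K => tailCutoff_nonneg K n) (fun K => min_le_right _ _) h1
      simp only [hterm]
      simpa using (h2.pow 2).mul_const (θ n * ‖u n‖ ^ 2)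
    · refine Eventually.of_forall fun K n => ?_
      have h3 : 0 ≤ θ n * ‖u n‖ ^ 2 := mul_nonneg (θ.nonneg n) (sq_nonneg _)
      rw [hterm, Real.norm_of_nonneg (by positivity)]
      exact mul_le_of_le_one_left h3 (pow_le_one₀ (tailCutoff_nonneg K n) (tailCutoff_le_one K n))
  rw [tsum_zero] at hsum
  simpa [norm_def] using hsum.sqrt

/-- The indicator of `|n| ≤ N`. -/
def siteIndicator (N : ℕ) (n : ℤ) : ℝ := if |n| ≤ (N : ℤ) then 1 else 0

theorem siteIndicator_nonneg (N : ℕ) (n : ℤ) : 0 ≤ siteIndicator N n := by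
  rw [siteIndicator]; split_ifs <;> simp

theorem siteIndicator_le_one (N : ℕ) (n : ℤ) : siteIndicator N n ≤ 1 := by
  rw [siteIndicator]; split_ifs <;> simp

/-- Truncation to the sites `|n| ≤ N`. -/
def truncation (θ : LatticeWeight) (N : ℕ) : WeightedL2 θ →L[ℂ] truncatedSpace θ N :=
  (mulBy (siteIndicator N) (siteIndicator_nonneg N) (siteIndicator_le_one N)).codRestrict
    (truncatedSpace θ N) fun u n hn => by
      rw [mulBy_apply, siteIndicator, if_neg (not_le.2 hn), Complex.ofReal_zero, zero_mul]

theorem truncation_apply_of_le {N : ℕ} {n : ℤ} (h : |n| ≤ (N : ℤ)) (u : WeightedL2 θ) :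
    (truncation θ N u : WeightedL2 θ) n = u n := by
  change mulBy (siteIndicator N) (siteIndicator_nonneg N) (siteIndicator_le_one N) u n = _
  rw [mulBy_apply, siteIndicator, if_pos h, Complex.ofReal_one, one_mul]

theorem truncation_apply_of_lt {N : ℕ} {n : ℤ} (h : (N : ℤ) < |n|) (u : WeightedL2 θ) :
    (truncation θ N u : WeightedL2 θ) n = 0 :=
  (truncation θ N u).2 n h

theorem norm_truncation_le (N : ℕ) (u : WeightedL2 θ) : ‖truncation θ N u‖ ≤ ‖u‖ :=
  norm_mulBy_le (siteIndicator N) (siteIndicator_nonneg N) (siteIndicator_le_one N) u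

theorem norm_sub_truncation_le (K : ℕ) (u : WeightedL2 θ) :
    ‖u - truncation θ K u‖ ≤ ‖tail K u‖ := by
  refine (norm_le_of_forall_le zero_le_one fun n => ?_).trans_eq (one_mul _)
  rw [sub_apply, one_mul]
  rcases le_or_gt |n| (K : ℤ) with h | h
  · simp [truncation_apply_of_le h]
  · rw [truncation_apply_of_lt h, sub_zero, tail_apply_of_lt h]

instance (θ : LatticeWeight) (N : ℕ) : InnerProductSpace ℝ (truncatedSpace θ N) :=
  InnerProductSpace.rclikeToReal ℂ _

theorem coe_inner {N : ℕ} (v w : truncatedSpace θ N) :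
    inner ℝ v w = inner ℝ (v : WeightedL2 θ) (w : WeightedL2 θ) := rfl

instance (θ : LatticeWeight) (N : ℕ) : FiniteDimensional ℂ (truncatedSpace θ N) := by
  let L : truncatedSpace θ N →ₗ[ℂ] (Finset.Icc (-(N : ℤ)) N → ℂ) :=
    { toFun := fun v n => (v : WeightedL2 θ) n
      map_add' := fun _ _ => rfl
      map_smul' := fun _ _ => rfl }
  refine FiniteDimensional.of_injective L fun v w h => Subtype.ext (ext_apply fun n => ?_)
  rcases le_or_gt |n| (N : ℤ) with hn | hn
  · exact congrFun h ⟨n, Finset.mem_Icc.2 (abs_le.1 hn)⟩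
  · rw [v.2 n hn, w.2 n hn]

instance (θ : LatticeWeight) (N : ℕ) : ProperSpace (truncatedSpace θ N) :=
  FiniteDimensional.proper ℂ _

/-- `v` vanishes where truncation acts, so projecting the field does not alter its pairing with `v`.
Every energy inequality thus passes to the finite systems with the same constants. -/
theorem inner_mulBy_truncation (ρ : ℤ → ℝ) (h0 : ∀ n, 0 ≤ ρ n) (h1 : ∀ n, ρ n ≤ 1) {N : ℕ}
    (w : WeightedL2 θ) (v : truncatedSpace θ N) :
    inner ℝ (mulBy ρ h0 h1 (truncation θ N w)) (mulBy ρ h0 h1 (v : WeightedL2 θ))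
      = inner ℝ (mulBy ρ h0 h1 w) (mulBy ρ h0 h1 (v : WeightedL2 θ)) := by
  refine (hasSum_inner _ _).unique ?_
  convert! hasSum_inner (mulBy ρ h0 h1 w) (mulBy ρ h0 h1 (v : WeightedL2 θ)) using 1
  funext n
  rcases le_or_gt |n| (N : ℤ) with hn | hn
  · simp only [mulBy_apply, truncation_apply_of_le hn]
  · simp only [mulBy_apply, v.2 n hn, mul_zero, inner_zero_right]

theorem mulBy_one (u : WeightedL2 θ) :
    mulBy (fun _ => 1) (fun _ => zero_le_one) (fun _ => le_rfl) u = u :=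
  ext_apply fun n => by simp

/-- The forcing of the energy beyond `K`, for solutions in the ball of radius `R`. -/
def tailForcing (P : LatticeParams) (D dlow dup ε : ℝ) (g : WeightedL2 θ) (R : ℝ) (K : ℕ) : ℝ :=
  cutoffConst P D dlow dup * (1 / ((K : ℝ) + 1)) * R ^ 2 + ‖tail K g‖ ^ 2 / (2 * ε)

theorem cutoffConst_nonneg (hWS : θ.WS D dlow dup) (P : LatticeParams) : 0 ≤ cutoffConst P D dlow dup := by
  have := hWS.D_pos
  have := hWS.dlow_pos
  have := hWS.dup_pos
  rw [cutoffConst]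
  positivity

theorem tailForcing_nonneg (hWS : θ.WS D dlow dup) (P : LatticeParams) (g : WeightedL2 θ) {ε : ℝ}
    (hε : 0 < ε) (R : ℝ) (K : ℕ) :
    0 ≤ tailForcing P D dlow dup ε g R K := by
  have := cutoffConst_nonneg hWS P
  rw [tailForcing]
  positivity

theorem tendsto_tailForcing (P : LatticeParams) (D dlow dup ε : ℝ) (g : WeightedL2 θ) (R : ℝ) :
    Tendsto (tailForcing P D dlow dup ε g R) atTop (𝓝 0) := by
  have h1 := ((tendsto_one_div_add_atTop_nhds_zero_nat (𝕜 := ℝ)).const_mul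
    (cutoffConst P D dlow dup)).mul_const (R ^ 2)
  have h2 := ((tendsto_norm_tail g).pow 2).div_const (2 * ε)
  have h3 := h1.add h2
  rw [mul_zero, zero_mul, zero_pow two_ne_zero, zero_div, add_zero] at h3
  exact h3

/-! ### Dissipativity of the two fields and equivalence with the lattice equations. -/

variable (hWS : θ.WS D dlow dup) (P : LatticeParams) (hp : 1 < P.p) (g : WeightedL2 θ) {ε : ℝ}

/-- The vector field of the truncated system. -/
def truncatedField (N : ℕ) (v : truncatedSpace θ N) : truncatedSpace θ N :=
  truncation θ N (latticeField hWS P hp g v)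

theorem inner_latticeField_le (hζ : 0 < P.ζ) (hε : 0 < ε) (u : WeightedL2 θ) :
    inner ℝ (latticeField hWS P hp g u) u
      ≤ -dissipationRate P D dlow dup ε * ‖u‖ ^ 2 + ‖g‖ ^ 2 / (2 * ε) := by
  simpa [mulBy_one] using inner_mulBy_latticeField_le hWS P hp hζ hε g u (fun _ => 1)
    (fun _ => zero_le_one) (fun _ => le_rfl) (κ := 0) (by simp)

theorem isDissipativeField_latticeField (hσ : 0 < dissipationRate P D dlow dup ε) (hζ : 0 < P.ζ)
    (hε : 0 < ε) :
    IsDissipativeField (latticeField hWS P hp g) (dissipationRate P D dlow dup ε)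
      (‖g‖ ^ 2 / (2 * ε)) where
  lipschitz := exists_lipschitzOnWith_latticeField hWS P hp g
  rate_pos := hσ
  inner_le := inner_latticeField_le hWS P hp g hζ hε

theorem isDissipativeField_truncatedField (hσ : 0 < dissipationRate P D dlow dup ε)
    (hζ : 0 < P.ζ) (hε : 0 < ε) (N : ℕ) :
    IsDissipativeField (truncatedField hWS P hp g N) (dissipationRate P D dlow dup ε)
      (‖g‖ ^ 2 / (2 * ε)) where
  lipschitz R := by
    obtain ⟨K, hK⟩ := exists_lipschitzOnWith_latticeField hWS P hp g R
    refine ⟨K, LipschitzOnWith.of_dist_le_mul fun u hu v hv => ?_⟩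
    have h := hK.dist_le_mul (u : WeightedL2 θ) (by simpa using hu) v (by simpa using hv)
    rw [dist_eq_norm] at h ⊢
    rw [truncatedField, truncatedField, ← map_sub]
    exact (norm_truncation_le N _).trans h
  rate_pos := hσ
  inner_le v := by
    have h := inner_mulBy_truncation (fun _ => 1) (fun _ => zero_le_one) (fun _ => le_rfl)
      (latticeField hWS P hp g v) v
    simp only [mulBy_one] at h
    rw [coe_inner, truncatedField, h]
    exact inner_latticeField_le hWS P hp g hζ hε v

theorem inner_tail_latticeField_le (hζ : 0 < P.ζ) (hε : 0 < ε) {R : ℝ} {u : WeightedL2 θ}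
    (hu : ‖u‖ ≤ R) (K : ℕ) :
    inner ℝ (tail K (latticeField hWS P hp g u)) (tail K u)
      ≤ -dissipationRate P D dlow dup ε * ‖tail K u‖ ^ 2 + tailForcing P D dlow dup ε g R K := by
  refine (inner_mulBy_latticeField_le hWS P hp hζ hε g u _ (tailCutoff_nonneg K)
    (tailCutoff_le_one K) (abs_tailCutoff_succ_sub_le K)).trans ?_
  have := cutoffConst_nonneg hWS P
  rw [tailForcing, tail]
  gcongr

theorem isLatticeSolution_iff (hcont : Continuous (latticeField hWS P hp g))
    (u : ℝ → WeightedL2 θ) :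
    IsLatticeSolution P g u ↔ IsForwardSolution (latticeField hWS P hp g) u := by
  constructor
  · rintro ⟨du, ⟨-, hder⟩, heq⟩ t ht
    have : du t = latticeField hWS P hp g (u t) :=
      ext_apply fun n => (latticeLHS_eq_iff P _ _ n _).1 (heq t ht n)
    exact this ▸ hder t ht
  · intro hu
    exact ⟨fun t => latticeField hWS P hp g (u t), ⟨hcont.comp_continuousOn hu.continuousOn, hu⟩,
      fun t _ n => (latticeLHS_eq_iff P _ _ n _).2 rfl⟩

theorem isTruncatedSolution_iff {N : ℕ} (hcont : Continuous (truncatedField hWS P hp g N))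
    (v : ℝ → truncatedSpace θ N) :
    IsTruncatedSolution P g N v ↔ IsForwardSolution (truncatedField hWS P hp g N) v := by
  constructor
  · rintro ⟨dv, ⟨-, hder⟩, heq⟩ t ht
    have : dv t = truncatedField hWS P hp g N (v t) := by
      refine Subtype.ext (ext_apply fun n => ?_)
      rcases le_or_gt |n| (N : ℤ) with hn | hn
      · rw [truncatedField, truncation_apply_of_le hn]
        exact (latticeLHS_eq_iff P _ _ n _).1 (heq t ht n hn)
      · rw [(dv t).2 n hn, (truncatedField hWS P hp g N (v t)).2 n hn]
    exact this ▸ hder t ht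
  · intro hv
    refine ⟨fun t => truncatedField hWS P hp g N (v t),
      ⟨hcont.comp_continuousOn hv.continuousOn, hv⟩,
      fun t _ n hn => (latticeLHS_eq_iff P _ _ n _).2 ?_⟩
    change (truncation θ N (latticeField hWS P hp g (v t)) : WeightedL2 θ) n = _
    rw [truncation_apply_of_le hn]
    rfl

/-! ### Asymptotic compactness and convergence of the attractors. -/

variable {S : ℝ≥0 → WeightedL2 θ → WeightedL2 θ}
  {SN : ∀ N : ℕ, ℝ≥0 → truncatedSpace θ N → truncatedSpace θ N}

/-- The tail energy decays at rate `2σ` to a level small for large `K`, so late orbit points are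
close to their truncations, which lie in a ball of a finite-dimensional space. -/
theorem isAsymptoticallyCompact (hσ : 0 < dissipationRate P D dlow dup ε) (hζ : 0 < P.ζ)
    (hε : 0 < ε) (hS : IsSolutionSemigroup (IsForwardSolution (latticeField hWS P hp g)) S) :
    IsAsymptoticallyCompact S := by
  have hf := isDissipativeField_latticeField hWS P hp g hσ hζ hε
  intro B hB η hη
  obtain ⟨R, hR⟩ := hB.exists_norm_le
  set σ := dissipationRate P D dlow dup ε
  set R' := Real.sqrt (R ^ 2 + ‖g‖ ^ 2 / (2 * ε) / σ)
  have hbound : ∀ x ∈ B, ∀ t : ℝ, 0 ≤ t → ‖S t.toNNReal x‖ ≤ R' := fun x hx t ht =>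
    hf.norm_le (hS x).2 ht (by simpa [(hS x).1] using hR x hx)
  obtain ⟨K, hK⟩ : ∃ K : ℕ, tailForcing P D dlow dup ε g R' K / σ < η ^ 2 / 2 := by
    have h := (tendsto_tailForcing P D dlow dup ε g R').div_const σ
    rw [zero_div] at h
    exact (h.eventually_lt_const (by positivity)).exists
  have hlim : Tendsto (fun t : ℝ≥0 => Real.exp (-(2 * σ) * t) * R ^ 2) atTop (𝓝 0) := by
    have h1 : Tendsto (fun t : ℝ≥0 => -(2 * σ) * (t : ℝ)) atTop atBot :=
      (NNReal.tendsto_coe_atTop.2 tendsto_id).const_mul_atTop_of_neg (by linarith)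
    simpa using (Real.tendsto_exp_atBot.comp h1).mul_const (R ^ 2)
  obtain ⟨T, hT⟩ := eventually_atTop.1 (hlim.eventually_lt_const (by positivity : 0 < η ^ 2 / 2))
  refine ⟨(fun v : truncatedSpace θ K => (v : WeightedL2 θ)) '' Metric.closedBall 0 R',
    (isCompact_closedBall 0 R').image continuous_subtype_val, T, fun t ht x hx => ?_⟩
  have hStx : ‖S t x‖ ≤ R' := by simpa using hbound x hx t t.coe_nonneg
  refine ⟨_, ⟨truncation θ K (S t x), by simpa using (norm_truncation_le K _).trans hStx, rfl⟩, ?_⟩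
  rw [dist_eq_norm]
  refine (norm_sub_truncation_le K _).trans ?_
  have h := (hS x).2.norm_sq_le ((tail K).restrictScalars ℝ) hσ
    (tailForcing_nonneg hWS P g hε R' K)
    (fun s hs => inner_tail_latticeField_le hWS P hp g hζ hε (hbound x hx s hs) K) t.coe_nonneg
  simp only [Real.toNNReal_coe, Real.toNNReal_zero, (hS x).1,
    ContinuousLinearMap.coe_restrictScalars'] at h
  have h2 : ‖tail K x‖ ≤ R := (norm_mulBy_le _ _ _ x).trans (hR x hx)
  have h3 : Real.exp (-(2 * σ) * t) * ‖tail K x‖ ^ 2 ≤ Real.exp (-(2 * σ) * t) * R ^ 2 := by gcongr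
  refine (pow_le_pow_iff_left₀ (norm_nonneg _) hη.le two_ne_zero).1 ?_
  linarith [hT t ht]

/-- The defect of a truncated state as a state of the infinite lattice. -/
theorem exists_norm_truncatedField_sub_le :
    ∃ c : ℝ, 0 ≤ c ∧ ∀ (K : ℕ) (v : truncatedSpace θ (K + 1)),
      ‖(truncatedField hWS P hp g (K + 1) v : WeightedL2 θ) - latticeField hWS P hp g v‖
        ≤ c * ‖tail K (v : WeightedL2 θ)‖ + ‖tail K g‖ := by
  let L : WeightedL2 θ →L[ℂ] WeightedL2 θ :=
    (-(Complex.I * ((P.α : ℂ) + Complex.I * (P.β : ℂ)))) •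
      (shift (-1) dup hWS.le_pred + shift 1 dlow⁻¹ hWS.le_succ)
  refine ⟨‖L‖, norm_nonneg _, fun K v => ?_⟩
  have hle : ‖(truncatedField hWS P hp g (K + 1) v : WeightedL2 θ) - latticeField hWS P hp g v‖
      ≤ 1 * ‖L (tail K (v : WeightedL2 θ)) + Complex.I • tail K g‖ := by
    refine norm_le_of_forall_le zero_le_one fun n => ?_
    rw [sub_apply, one_mul]
    rcases le_or_gt |n| ((K + 1 : ℕ) : ℤ) with hn | hn
    · rw [truncatedField, truncation_apply_of_le hn, sub_self, norm_zero]
      exact norm_nonneg _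
    -- Outside the truncated range `v n = 0`, so only neighbours and `g` contribute. A neighbour of
    -- `n` still lies beyond `K`, where the cut-off is `1`; this is why the range is `K + 1`.
    · have hn' : (K : ℤ) + 1 < |n| := by exact_mod_cast hn
      have hL : (K : ℤ) < |n + -1| := by
        have := abs_sub_abs_le_abs_sub n 1
        rw [abs_one] at this
        have e : n + -1 = n - 1 := rfl
        rw [e]; linarith
      have hR : (K : ℤ) < |n + 1| := by
        have := abs_sub_abs_le_abs_sub n (-1)
        rw [abs_neg, abs_one, sub_neg_eq_add] at this
        linarith
      refine le_of_eq (congrArg _ ?_)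
      rw [truncatedField, truncation_apply_of_lt hn, latticeField_apply]
      simp only [L, add_apply, smul_apply, _root_.smul_apply,
        _root_.add_apply, shift_apply, tail_apply_of_lt hL, tail_apply_of_lt hR,
        tail_apply_of_lt (show (K : ℤ) < |n| by linarith), siteField, v.2 n hn, gaugeF, mul_zero]
      rw [← sub_eq_add_neg n 1]
      ring
  rw [one_mul] at hle
  refine hle.trans ((norm_add_le _ _).trans (add_le_add (L.le_opNorm _) ?_))
  rw [norm_smul, Complex.norm_I, one_mul]

/-- Orbits in `A_N` are compared with exact orbits only up to a fixed time `T`; `T` depends on the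
tolerance but not on `N`, so Gronwall's exponential growth is harmless. -/
theorem tendsto_hausdorffSemidist_attractor (hσ : 0 < dissipationRate P D dlow dup ε)
    (hζ : 0 < P.ζ) (hε : 0 < ε)
    (hS : IsSolutionSemigroup (IsForwardSolution (latticeField hWS P hp g)) S)
    (hSN : ∀ N, IsSolutionSemigroup (IsForwardSolution (truncatedField hWS P hp g N)) (SN N))
    {A : Set (WeightedL2 θ)} {AN : ∀ N : ℕ, Set (truncatedSpace θ N)}
    (hA : IsGlobalAttractor S A) (hAN : ∀ N, IsGlobalAttractor (SN N) (AN N)) :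
    Tendsto (fun N : ℕ =>
      hausdorffSemidist ((fun v : truncatedSpace θ N => (v : WeightedL2 θ)) '' AN N) A)
      atTop (𝓝 0) := by
  have hf := isDissipativeField_latticeField hWS P hp g hσ hζ hε
  have hfN := isDissipativeField_truncatedField hWS P hp g hσ hζ hε
  set σ := dissipationRate P D dlow dup ε with hσdef
  set C := ‖g‖ ^ 2 / (2 * ε) with hC
  set R := Real.sqrt (C / σ) with hR
  have hCσ : 0 ≤ C / σ := div_nonneg hf.const_nonneg hσ.le
  have hRsq : R ^ 2 = C / σ := Real.sq_sqrt hCσ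
  have hbound : ∀ N, ∀ v ∈ AN N, ‖(v : WeightedL2 θ)‖ ≤ R := fun N v hv =>
    Real.le_sqrt_of_sq_le ((hfN N).norm_sq_le_of_mem_attractor (hSN N) (hAN N)
      (ContinuousLinearMap.id ℝ _) hf.const_nonneg (fun w _ => (hfN N).inner_le w) hv)
  have htail : ∀ N, ∀ v ∈ AN N, ∀ K : ℕ,
      ‖tail K (v : WeightedL2 θ)‖ ≤ Real.sqrt (tailForcing P D dlow dup ε g R K / σ) := by
    intro N v hv K
    refine Real.le_sqrt_of_sq_le ((hfN N).norm_sq_le_of_mem_attractor (hSN N) (hAN N)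
      (((tail K) ∘L (truncatedSpace θ N).subtypeL).restrictScalars ℝ)
      (tailForcing_nonneg hWS P g hε R K) (fun w hw => ?_) hv)
    exact (inner_mulBy_truncation _ _ _ _ _).trans_le
      (inner_tail_latticeField_le hWS P hp g hζ hε (hbound N w hw) K)
  obtain ⟨c, hc, hdefect⟩ := exists_norm_truncatedField_sub_le hWS P hp g
  obtain ⟨M, hM⟩ := hf.exists_dist_le R
  refine tendsto_hausdorffSemidist_zero fun η hη => ?_
  obtain ⟨T, hT⟩ := (eventually_exists_dist_lt (hA.attracts (Metric.closedBall 0 R)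
    Metric.isBounded_closedBall) (half_pos hη)).exists
  have hgron : Tendsto (fun K : ℕ => gronwallBound 0 M
      (c * Real.sqrt (tailForcing P D dlow dup ε g R K / σ) + ‖tail K g‖) T) atTop (𝓝 0) := by
    have h1 := (((tendsto_tailForcing P D dlow dup ε g R).div_const σ).sqrt.const_mul c).add (tendsto_norm_tail g)
    rw [zero_div, Real.sqrt_zero, mul_zero, add_zero] at h1
    have h2 := ((gronwallBound_continuous_ε 0 M T).tendsto 0).comp h1
    rwa [gronwallBound_ε0_δ0] at h2
  -- The defect bound is available for `N = K + 1`, so the limit is taken along `K`.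
  rw [← map_add_atTop_eq_nat 1, eventually_map]
  filter_upwards [hgron.eventually_lt_const (half_pos hη)] with K hK
  rintro _ ⟨x, hx, rfl⟩
  obtain ⟨w, hw, rfl⟩ : x ∈ SN (K + 1) T '' AN (K + 1) := by rwa [(hAN (K + 1)).invariant T]
  have hmem : ∀ t : ℝ, SN (K + 1) t.toNNReal w ∈ AN (K + 1) := fun t => by
    rw [← (hAN (K + 1)).invariant t.toNNReal]; exact ⟨w, hw, rfl⟩
  obtain ⟨y, hy, hxy⟩ := hT (S T w) ⟨w, by simpa using hbound _ w hw, rfl⟩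
  refine ⟨y, hy, ?_⟩
  -- Both curves start at the same `w`, so the Gronwall bound contains only the defect.
  have hcomp := hM (fun t => S t.toNNReal w) (fun t => (SN (K + 1) t.toNNReal w : WeightedL2 θ))
    (fun t => (truncatedField hWS P hp g (K + 1) (SN (K + 1) t.toNNReal w) : WeightedL2 θ))
    (c * Real.sqrt (tailForcing P D dlow dup ε g R K / σ) + ‖tail K g‖) (hS w).2
    (fun t ht => (((truncatedSpace θ (K + 1)).subtypeL.restrictScalars
      ℝ).hasFDerivAt.comp_hasDerivWithinAt t ((hSN (K + 1) w).2 t ht)))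
    (fun t ht => by
      rw [dist_eq_norm]
      refine (hdefect K _).trans ?_
      have := htail _ _ (hmem t) K
      gcongr)
    (by simpa [(hS _).1] using hbound _ w hw)
    (fun t ht => (hbound _ _ (hmem t)).trans (by
      rw [hRsq]; exact Real.sqrt_le_sqrt (by linarith)))
    T T.coe_nonneg
  simp only [Real.toNNReal_coe, Real.toNNReal_zero, (hS _).1, (hSN (K + 1) w).1, dist_self]
    at hcomp
  have := dist_triangle_left ((SN (K + 1) T w : truncatedSpace θ (K + 1)) : WeightedL2 θ) y
    (S T w)
  linarith

end WeightedL2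

end

theorem theorem4p2 (θ : LatticeWeight) (D dlow dup : ℝ) (hWS : θ.WS D dlow dup)
    (P : LatticeParams) (hp : 1 < P.p) (ε : ℝ) (hε : 0 < ε)
    (hσ : 0 < P.δ - ε / 2 - 2 * P.β - |P.α| * D * dlow ^ (-(1 / 2) : ℝ)
      - |P.β| * (1 + dup / 2 + dlow⁻¹ / 2))
    (hζ : 0 < P.ζ) (g : WeightedL2 θ) :
    (∃! S : ℝ≥0 → WeightedL2 θ → WeightedL2 θ,
      IsSolutionSemigroup (IsLatticeSolution P g) S) ∧
    (∀ N : ℕ, ∃! S : ℝ≥0 → truncatedSpace θ N → truncatedSpace θ N,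
      IsSolutionSemigroup (IsTruncatedSolution P g N) S) ∧
    ∀ (S : ℝ≥0 → WeightedL2 θ → WeightedL2 θ)
      (SN : ∀ N : ℕ, ℝ≥0 → truncatedSpace θ N → truncatedSpace θ N),
      IsSolutionSemigroup (IsLatticeSolution P g) S →
      (∀ N : ℕ, IsSolutionSemigroup (IsTruncatedSolution P g N) (SN N)) →
      (∃! A : Set (WeightedL2 θ), IsGlobalAttractor S A) ∧
      (∀ N : ℕ, ∃! AN : Set (truncatedSpace θ N), IsGlobalAttractor (SN N) AN) ∧
      ∀ (A : Set (WeightedL2 θ)) (AN : ∀ N : ℕ, Set (truncatedSpace θ N)),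
        IsGlobalAttractor S A → (∀ N : ℕ, IsGlobalAttractor (SN N) (AN N)) →
        Tendsto (fun N : ℕ =>
          hausdorffSemidist ((fun v : truncatedSpace θ N => (v : WeightedL2 θ)) '' AN N) A)
          atTop (𝓝 0) := by
  have hf := WeightedL2.isDissipativeField_latticeField hWS P hp g hσ hζ hε
  have hfN := WeightedL2.isDissipativeField_truncatedField hWS P hp g hσ hζ hε
  have hsol : IsLatticeSolution P g = IsForwardSolution (WeightedL2.latticeField hWS P hp g) :=
    funext fun u => propext (WeightedL2.isLatticeSolution_iff hWS P hp g hf.continuous u)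
  have hsolN : ∀ N, IsTruncatedSolution P g N
      = IsForwardSolution (WeightedL2.truncatedField hWS P hp g N) := fun N =>
    funext fun v => propext (WeightedL2.isTruncatedSolution_iff hWS P hp g (hfN N).continuous v)
  simp only [hsol, hsolN]
  refine ⟨hf.existsUnique_isSolutionSemigroup,
    fun N => (hfN N).existsUnique_isSolutionSemigroup, fun S SN hS hSN => ⟨?_, fun N => ?_, ?_⟩⟩
  · exact (hf.isDissipativeSemigroup hS).existsUnique_isGlobalAttractor
      (WeightedL2.isAsymptoticallyCompact hWS P hp g hσ hζ hε hS)
  · have h := (hfN N).isDissipativeSemigroup (hSN N)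
    exact h.existsUnique_isGlobalAttractor h.isAsymptoticallyCompact_of_properSpace
  · intro A AN hA hAN
    exact WeightedL2.tendsto_hausdorffSemidist_attractor hWS P hp g hσ hζ hε hS hSN hA hAN
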